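/- **Setting.** Let $\mathbb{S}^n$ be the real inner product space of $n\times n$ real symmetric matrices, or of $n\times n$ Hermitian matrices, with $\langle X,Y\rangle=\mathrm{Re}\,\mathrm{Tr}(X^{\mathbb T}Y)$ and $\|X\|_F=\langle X,X\rangle^{1/2}$, where $^{\mathbb T}$ is the transpose in the real and the conjugate transpose in the complex case; $\mathbb{S}^n_+$ and $\mathbb{S}^n_{++}$ are the sets of positive semidefinite and positive definite elements. Let $\Theta_1,\dots,\Theta_d$ be an orthonormal basis of $\mathbb{S}^n$, let $\alpha\subseteq\{1,\dots,d\}$, $\beta=\{1,\dots,d\}\setminus\alpha$, and let $\overline X\in\mathbb{S}^n_+$ have rank $r\ge 1$. Assume that there is $X^0\in\mathbb{S}^n_{++}$ with $\langle\Theta_k,X^0\rangle=\langle\Theta_k,\overline X\rangle$ for all $k\in\alpha$ (Slater condition). Let $\omega_1,\omega_2,\dots$ be i.i.d. random indices with $\Pr(\omega_i=k)=p_k$, where $p_k=0$ for $k\in\alpha$ and $p_k>0$ for $k\in\beta$; let $\xi_1,\xi_2,\dots$ be i.i.d. real noises, independent of the indices, with $\mathbb E\xi_i=0$ and $\mathbb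 E\xi_i^2=1$; let $\nu>0$ and $y_i=\langle\Theta_{\omega_i},\overline X\rangle+\nu\xi_i$. Put $$\mathcal Q_\beta^\dagger(X)=\sum_{k\in\beta}\frac1{p_k}\langle\Theta_k,X\rangle\Theta_k .$$ Let $f:\mathbb R^n\to\mathbb R^n$ be symmetric, i.e. $f(x)=Q^{\mathbb T}f(Qx)$ for all $x\in\mathbb{R}^n$ and all signed permutation matrices $Q$, and let $F$ be the associated spectral operator on $\mathbb{S}^n$: $F(X)=U\,\mathrm{Diag}(f(\sigma(X)))\,V^{\mathbb T}$ for every singular value decomposition $X=U\,\mathrm{Diag}(\sigma(X))V^{\mathbb T}$ with nonincreasing singular values. Assume that $F$ is continuous at $\overline X$. Let $\widetilde X_m\in\mathbb{S}^n_+$ be random matrices (initial estimators) with $\widetilde X_m\to\overline X$ in probability as $m\to\infty$. Let $\rho_m>0$ be real numbers and $\gamma_m\ge0$ (possibly random) parameters. Let $\widehat X_m$ be an estimator that is an optimal solution of $$\min_{X\in\mathbb{S}^n_+}\ \frac1{2m}\sum_{i=1}^m\big(y_i-\langle\Theta_{\omega_i},X\rangle\big)^2+\rho_m\Big(\langle I_n-F(\widetilde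 X_m),X\rangle+\frac{\gamma_m}2\|X-\widetilde X_m\|_F^2\Big)\quad\text{s.t.}\quad \langle\Theta_k,X\rangle=\langle\Theta_k,\overline X\rangle\ \ (k\in\alpha)$$ almost surely whenever this problem has an optimal solution. It is called rank consistent if $\lim_{m\to\infty}\Pr(\mathrm{rank}(\widehat X_m)=\mathrm{rank}(\overline X))=1$. Let $\overline P=[\overline P_1\ \overline P_2]$ be any orthogonal (unitary) matrix with $\overline X=\overline P\,\mathrm{Diag}(\lambda)\,\overline P^{\mathbb T}$, where $\lambda$ is the vector of the eigenvalues of $\overline X$ in nonincreasing order and $\overline P_2$ consists of the last $n-r$ columns of $\overline P$. **Theorem.** Suppose that $\rho_m\to0$, $\sqrt m\,\rho_m\to\infty$ and $\gamma_m=O_p(1)$ (bounded in probability). If $\widehat X_m$ is rank consistent, then the linear system $$\overline P_2^{\mathbb T}\,\mathcal Q_\beta^\dagger\big(\overline P_2\Lambda\overline P_2^{\mathbb T}\big)\overline P_2=\overline P_2^{\mathbb T}\,\mathcal Q_\beta^\dagger\big(I_n-F(\overline X)\big)\overline P_2$$ has a solution $\widehat\Lambda\in\mathbb{S}^{n-r}_+$.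 -/

import Mathlib

open MeasureTheory ProbabilityTheory Filter Topology Matrix
open scoped ComplexOrder

namespace RankCorrection

section Matrices

variable {𝕜 : Type*} [RCLike 𝕜] {n : ℕ}

/-- The trace inner product `⟨X, Y⟩ = Re Tr(Xᴴ Y)`. -/
noncomputable def trInner (X Y : Matrix (Fin n) (Fin n) 𝕜) : ℝ :=
  RCLike.re (Xᴴ * Y).trace

/-- The Frobenius norm, induced by the trace inner product. -/
noncomputable def frobNorm (X : Matrix (Fin n) (Fin n) 𝕜) : ℝ :=
  Real.sqrt (trInner X X)

/-- The rectangular diagonal matrix (here square) with real diagonal entries `x i`. -/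
def realDiag (𝕜 : Type*) [RCLike 𝕜] {n : ℕ} (x : Fin n → ℝ) : Matrix (Fin n) (Fin n) 𝕜 :=
  Matrix.diagonal fun i => (x i : 𝕜)

/-- `Θ` is an orthonormal basis, for the trace inner product, of the real inner product space of
symmetric (`𝕜 = ℝ`) or Hermitian (`𝕜 = ℂ`) matrices of size `n`. -/
structure IsHermitianOrthonormalBasis {d : ℕ} (Θ : Fin d → Matrix (Fin n) (Fin n) 𝕜) : Prop where
  orthonormal : ∀ k l, trInner (Θ k) (Θ l) = if k = l then 1 else 0
  span_eq : Submodule.span ℝ (Set.range Θ) =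
    selfAdjoint.submodule ℝ (Matrix (Fin n) (Fin n) 𝕜)

/-- `X = U Diag(s) Vᴴ` is a singular value decomposition of `X` with the singular values
arranged in nonincreasing order. -/
structure IsSVD (U V : Matrix (Fin n) (Fin n) 𝕜) (s : Fin n → ℝ)
    (X : Matrix (Fin n) (Fin n) 𝕜) : Prop where
  left_mem : U ∈ Matrix.unitaryGroup (Fin n) 𝕜
  right_mem : V ∈ Matrix.unitaryGroup (Fin n) 𝕜
  antitone : Antitone s
  nonneg : ∀ i, 0 ≤ s i
  eq : X = U * realDiag 𝕜 s * Vᴴ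

/-- The set `𝕆ⁿ(X)` of the orthogonal (unitary) `P` with `X = P Diag(λ) Pᴴ`, where `λ` is the
vector of the eigenvalues of `X` in the order of nonincreasing absolute value. -/
def orderedEigenbases (X : Matrix (Fin n) (Fin n) 𝕜) : Set (Matrix (Fin n) (Fin n) 𝕜) :=
  {P | P ∈ Matrix.unitaryGroup (Fin n) 𝕜 ∧
    ∃ l : Fin n → ℝ, Antitone (fun i => |l i|) ∧ X = P * realDiag 𝕜 l * Pᴴ}

/-- The last `n - r` columns of `P`: the block `P₂` of `P = [P₁ P₂]`. -/
def lastCols (r : ℕ) (P : Matrix (Fin n) (Fin n) 𝕜) : Matrix (Fin n) (Fin (n - r)) 𝕜 :=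
  P.submatrix id fun j => ⟨r + j.1, by have := j.2; omega⟩

/-- A signed permutation matrix: exactly one nonzero entry, equal to `1` or `-1`, in each row and
in each column. -/
structure IsSignedPermutation (Q : Matrix (Fin n) (Fin n) ℝ) : Prop where
  entries : ∀ i j, Q i j = 0 ∨ Q i j = 1 ∨ Q i j = -1
  row : ∀ i, ∃! j, Q i j ≠ 0
  col : ∀ j, ∃! i, Q i j ≠ 0

/-- `f : ℝⁿ → ℝⁿ` is symmetric: `f x = Qᵀ f (Q x)` for all signed permutation matrices `Q`. -/
def IsSymmetricFun (f : (Fin n → ℝ) → (Fin n → ℝ)) : Prop :=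
  ∀ Q : Matrix (Fin n) (Fin n) ℝ, IsSignedPermutation Q → ∀ x, f x = Qᵀ *ᵥ f (Q *ᵥ x)

/-- `F` is the spectral operator, on the symmetric (Hermitian) matrices, of the symmetric function
`f`: `F X = U Diag(f(σ(X))) Vᴴ` for every singular value decomposition `X = U Diag(σ(X)) Vᴴ`. -/
structure IsSpectralOperator (f : (Fin n → ℝ) → (Fin n → ℝ))
    (F : Matrix (Fin n) (Fin n) 𝕜 → Matrix (Fin n) (Fin n) 𝕜) : Prop where
  symmetric : IsSymmetricFun f
  eq : ∀ (X U V : Matrix (Fin n) (Fin n) 𝕜) (s : Fin n → ℝ), X.IsHermitian →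
    IsSVD U V s X → F X = U * realDiag 𝕜 (f s) * Vᴴ

/-- The operator `Q_β^†(X) = ∑_{k ∈ β} (1 / p_k) ⟨Θ_k, X⟩ Θ_k`. -/
noncomputable def Qdag {d : ℕ} (Θ : Fin d → Matrix (Fin n) (Fin n) 𝕜) (β : Finset (Fin d))
    (p : Fin d → ℝ) (X : Matrix (Fin n) (Fin n) 𝕜) : Matrix (Fin n) (Fin n) 𝕜 :=
  ∑ k ∈ β, ((1 / p k) * trInner (Θ k) X) • Θ k

/-- The feasible set of the positive semidefinite rank-correction step: the positive semidefinite
matrices whose basis coefficients with index in `α` are those of `Xbar`. -/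
def feasibleSet {d : ℕ} (Θ : Fin d → Matrix (Fin n) (Fin n) 𝕜) (α : Finset (Fin d))
    (Xbar : Matrix (Fin n) (Fin n) 𝕜) : Set (Matrix (Fin n) (Fin n) 𝕜) :=
  {X | X.PosSemidef ∧ ∀ k ∈ α, trInner (Θ k) X = trInner (Θ k) Xbar}

/-- The objective function of the positive semidefinite rank-correction step with `m` sampled
indices `w 0, …, w (m-1)`, observations `y 0, …, y (m-1)`, regularization parameters `ρ`, `γ`,
initial estimator `Xtil` and `G = F(Xtil)`:
`(1/2m) ‖y - R_Ω(X)‖₂² + ρ (⟨I - G, X⟩ + (γ/2) ‖X - Xtil‖_F²)`. -/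
noncomputable def objective {d : ℕ} (Θ : Fin d → Matrix (Fin n) (Fin n) 𝕜) (m : ℕ)
    (w : ℕ → Fin d) (y : ℕ → ℝ) (ρ γ : ℝ) (G Xtil X : Matrix (Fin n) (Fin n) 𝕜) : ℝ :=
  1 / (2 * (m : ℝ)) * ∑ i ∈ Finset.range m, (y i - trInner (Θ (w i)) X) ^ 2
    + ρ * (trInner (1 - G) X + γ / 2 * frobNorm (X - Xtil) ^ 2)

/-- `X` is an optimal solution of the problem of minimizing `φ` over `S`. -/
def IsOptimal {E : Type*} (S : Set E) (φ : E → ℝ) (X : E) : Prop :=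
  X ∈ S ∧ IsMinOn φ S X

end Matrices

section Probability

variable {Ω : Type*} [MeasurableSpace Ω]

/-- Sampled indices and noises. The pairs `(ω_i, ξ_i)` are i.i.d. with `ω_i` independent of `ξ_i`,
`ω_i` takes the value `k` with probability `p_k`, where `p_k = 0` for `k ∈ α` and `p_k > 0`
for `k ∉ α`, and the noises have mean zero and second moment one. -/
structure IsSamplingModel {d : ℕ} (μ : Measure Ω) (α : Finset (Fin d)) (p : Fin d → ℝ)
    (w : ℕ → Ω → Fin d) (ξ : ℕ → Ω → ℝ) : Prop where
  measurable_index : ∀ i, Measurable (w i)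
  measurable_noise : ∀ i, Measurable (ξ i)
  indep : iIndepFun (fun i a => (w i a, ξ i a)) μ
  indep_index_noise : ∀ i, IndepFun (w i) (ξ i) μ
  prob_fixed : ∀ k ∈ α, p k = 0
  prob_pos : ∀ k, k ∉ α → 0 < p k
  law_index : ∀ i k, μ.real {a | w i a = k} = p k
  ident_noise : ∀ i, IdentDistrib (ξ i) (ξ 0) μ μ
  memLp_noise : ∀ i, MemLp (ξ i) 2 μ
  mean_noise : ∀ i, ∫ a, ξ i a ∂μ = 0
  sq_noise : ∀ i, ∫ a, ξ i a ^ 2 ∂μ = 1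

/-- `x_m = O_p(1)`: the sequence of real random variables is bounded in probability. -/
def BoundedInProbability (μ : Measure Ω) (x : ℕ → Ω → ℝ) : Prop :=
  ∀ ε : ℝ, 0 < ε → ∃ C : ℝ, ∀ᶠ m in atTop, μ {a | C < |x m a|} ≤ ENNReal.ofReal ε

/-- Rank consistency: `Pr(rank(X_m) = rank(Xbar)) → 1`. -/
def RankConsistent {𝕜 : Type*} [RCLike 𝕜] {n : ℕ} (μ : Measure Ω)
    (X : ℕ → Ω → Matrix (Fin n) (Fin n) 𝕜) (Xbar : Matrix (Fin n) (Fin n) 𝕜) : Prop :=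
  Tendsto (fun m => μ {a | (X m a).rank = Xbar.rank}) atTop (𝓝 1)

end Probability

end RankCorrection

/-! Write `M = 1 - F Xbar`, and let `P₂` be the block of eigenvectors spanning the kernel of `Xbar`.
Errors of the estimator live at scale `ρ_m`: the averaged noise has size `m^{-1/2}`, which is
negligible against `ρ_m`, while the sampling frequencies tend to `p` and give the quadratic loss a
uniform curvature off `α`. The scaled error `u = (Xhat - Xbar) / ρ_m` is therefore bounded and has a
limit point. Passing to the limit in the first-order condition, the coefficients `p_k u_k + ⟨Θ_k,
M⟩` pair nonnegatively with every feasible displacement at `Xbar`.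

Under Slater's condition (`exists_multiplier`) these coefficients agree off `α` with those of some
`T ⪰ 0` with `⟨T, Xbar⟩ = 0`. Such a `T` equals `P₂ Λ P₂ᴴ` with `Λ = P₂ᴴ T P₂ ⪰ 0`
(`eq_lastCols_conj_of_trInner_eq_zero`). Dividing by `p_k` gives `Q†(T) = u + Q†(M)`. A constant
rank along the sequence forces `P₂ᴴ u P₂ = 0` (`lastCols_conj_eq_zero_of_rank_eq`), and compressing
by `P₂` leaves the linear system.

The conclusion is deterministic, so probability only has to supply one sequence of realizations with
`m → ∞`, correct rank, vanishing perturbations and bounded `γ`. Second-moment bounds and a union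
bound provide it (`tendsto_measure_scaled_sum`, `eventually_exists_good_point`). -/

namespace RankCorrection

/-! ### Coordinates in the orthonormal basis; topology of the semidefinite cone -/

section Coordinates

variable {𝕜 : Type*} [RCLike 𝕜] {n d : ℕ}

lemma trInner_comm (X Y : Matrix (Fin n) (Fin n) 𝕜) : trInner X Y = trInner Y X := by
  unfold trInner
  rw [← RCLike.conj_re, starRingEnd_apply, ← trace_conjTranspose, conjTranspose_mul,
    conjTranspose_conjTranspose]

lemma trInner_add_right (X Y Z : Matrix (Fin n) (Fin n) 𝕜) :
    trInner X (Y + Z) = trInner X Y + trInner X Z := by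
  simp [trInner, Matrix.mul_add]

lemma trInner_sub_right (X Y Z : Matrix (Fin n) (Fin n) 𝕜) :
    trInner X (Y - Z) = trInner X Y - trInner X Z := by
  simp [trInner, Matrix.mul_sub]

lemma trInner_add_left (X Y Z : Matrix (Fin n) (Fin n) 𝕜) :
    trInner (X + Y) Z = trInner X Z + trInner Y Z := by
  simp [trInner, Matrix.add_mul]

lemma trInner_smul_right (c : ℝ) (X Y : Matrix (Fin n) (Fin n) 𝕜) :
    trInner X (c • Y) = c * trInner X Y := by
  simp [trInner, RCLike.smul_re]

lemma trInner_sum_right {ι : Type*} (s : Finset ι) (X : Matrix (Fin n) (Fin n) 𝕜)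
    (Y : ι → Matrix (Fin n) (Fin n) 𝕜) :
    trInner X (∑ i ∈ s, Y i) = ∑ i ∈ s, trInner X (Y i) := by
  simp [trInner, Matrix.mul_sum, trace_sum]

lemma continuous_trInner_right (X : Matrix (Fin n) (Fin n) 𝕜) :
    Continuous fun Y => trInner X Y := by
  unfold trInner
  exact RCLike.continuous_re.comp (Continuous.matrix_trace (continuous_const.matrix_mul continuous_id))

/-- The matrix with coordinates `z` in the family `Θ`. -/
noncomputable def ofCoords (Θ : Fin d → Matrix (Fin n) (Fin n) 𝕜) (z : Fin d → ℝ) :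
    Matrix (Fin n) (Fin n) 𝕜 :=
  ∑ k, z k • Θ k

/-- The coordinates of a matrix in the orthonormal family `Θ`. -/
noncomputable def coords (Θ : Fin d → Matrix (Fin n) (Fin n) 𝕜)
    (X : Matrix (Fin n) (Fin n) 𝕜) (k : Fin d) : ℝ :=
  trInner (Θ k) X

lemma ofCoords_add (Θ : Fin d → Matrix (Fin n) (Fin n) 𝕜) (x z : Fin d → ℝ) :
    ofCoords Θ (x + z) = ofCoords Θ x + ofCoords Θ z := by
  simp [ofCoords, add_smul, Finset.sum_add_distrib]

lemma ofCoords_smul (Θ : Fin d → Matrix (Fin n) (Fin n) 𝕜) (c : ℝ) (z : Fin d → ℝ) :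
    ofCoords Θ (c • z) = c • ofCoords Θ z := by
  simp [ofCoords, Finset.smul_sum, smul_smul]

lemma ofCoords_zero (Θ : Fin d → Matrix (Fin n) (Fin n) 𝕜) : ofCoords Θ 0 = 0 := by
  simp [ofCoords]

lemma continuous_ofCoords (Θ : Fin d → Matrix (Fin n) (Fin n) 𝕜) : Continuous (ofCoords Θ) := by
  unfold ofCoords
  fun_prop

lemma trInner_ofCoords (Θ : Fin d → Matrix (Fin n) (Fin n) 𝕜) (X : Matrix (Fin n) (Fin n) 𝕜)
    (z : Fin d → ℝ) : trInner X (ofCoords Θ z) = ∑ k, coords Θ X k * z k := by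
  simp only [ofCoords, trInner_sum_right, trInner_smul_right, coords]
  exact Finset.sum_congr rfl fun k _ => by rw [trInner_comm, mul_comm]

variable {Θ : Fin d → Matrix (Fin n) (Fin n) 𝕜}

lemma IsHermitianOrthonormalBasis.coords_ofCoords (hΘ : IsHermitianOrthonormalBasis Θ)
    (z : Fin d → ℝ) : coords Θ (ofCoords Θ z) = z := by
  funext k
  simp [coords, ofCoords, trInner_sum_right, trInner_smul_right, hΘ.orthonormal]

lemma IsHermitianOrthonormalBasis.isHermitian_ofCoords (hΘ : IsHermitianOrthonormalBasis Θ)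
    (z : Fin d → ℝ) : (ofCoords Θ z).IsHermitian := by
  have h : ofCoords Θ z ∈ selfAdjoint.submodule ℝ (Matrix (Fin n) (Fin n) 𝕜) := by
    rw [← hΘ.span_eq]
    exact Submodule.sum_mem _ fun k _ =>
      Submodule.smul_mem _ _ (Submodule.subset_span (Set.mem_range_self k))
  exact h

lemma IsHermitianOrthonormalBasis.ofCoords_coords (hΘ : IsHermitianOrthonormalBasis Θ)
    {X : Matrix (Fin n) (Fin n) 𝕜} (hX : X.IsHermitian) : ofCoords Θ (coords Θ X) = X := by
  have h : X ∈ selfAdjoint.submodule ℝ (Matrix (Fin n) (Fin n) 𝕜) := hX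
  rw [← hΘ.span_eq, Submodule.mem_span_range_iff_exists_fun] at h
  obtain ⟨c, rfl⟩ := h
  exact congrArg (ofCoords Θ) (hΘ.coords_ofCoords c)

lemma posSemidef_iff_re {X : Matrix (Fin n) (Fin n) 𝕜} (hX : X.IsHermitian) :
    X.PosSemidef ↔ ∀ v : Fin n → 𝕜, 0 ≤ RCLike.re (star v ⬝ᵥ (X *ᵥ v)) := by
  refine ⟨fun h v => h.re_dotProduct_nonneg v, fun h => .of_dotProduct_mulVec_nonneg hX fun v => ?_⟩
  rw [RCLike.nonneg_iff]
  exact ⟨h v, hX.im_star_dotProduct_mulVec_self v⟩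

lemma posDef_iff_re {X : Matrix (Fin n) (Fin n) 𝕜} (hX : X.IsHermitian) :
    X.PosDef ↔ ∀ v : Fin n → 𝕜, v ≠ 0 → 0 < RCLike.re (star v ⬝ᵥ (X *ᵥ v)) := by
  refine ⟨fun h v hv => h.re_dotProduct_pos hv,
    fun h => .of_dotProduct_mulVec_pos hX fun v hv => ?_⟩
  rw [RCLike.pos_iff]
  exact ⟨h v hv, hX.im_star_dotProduct_mulVec_self v⟩

lemma posDef_iff_re_sphere {X : Matrix (Fin n) (Fin n) 𝕜} (hX : X.IsHermitian) :
    X.PosDef ↔ ∀ v ∈ Metric.sphere (0 : Fin n → 𝕜) 1, 0 < RCLike.re (star v ⬝ᵥ (X *ᵥ v)) := by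
  rw [posDef_iff_re hX]
  refine ⟨fun h v hv => h v ?_, fun h v hv => ?_⟩
  · rintro rfl
    simp at hv
  · have hn : ‖v‖ ≠ 0 := norm_ne_zero_iff.2 hv
    have := h ((‖v‖⁻¹ : ℝ) • v) (by simp [norm_smul, hn])
    rw [star_smul, mulVec_smul, smul_dotProduct, dotProduct_smul, RCLike.smul_re,
      RCLike.smul_re] at this
    simp only [star_trivial] at this
    have h2 : 0 < ‖v‖⁻¹ := by positivity
    exact pos_of_mul_pos_right (pos_of_mul_pos_right this h2.le) h2.le

lemma re_dotProduct_smul_mulVec (c : ℝ) (X : Matrix (Fin n) (Fin n) 𝕜) (v : Fin n → 𝕜) :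
    RCLike.re (star v ⬝ᵥ ((c • X) *ᵥ v)) = c * RCLike.re (star v ⬝ᵥ (X *ᵥ v)) := by
  rw [smul_mulVec, dotProduct_smul, RCLike.smul_re]

lemma posSemidef_smul_real {X : Matrix (Fin n) (Fin n) 𝕜} (hX : X.PosSemidef) {c : ℝ}
    (hc : 0 ≤ c) : (c • X).PosSemidef := by
  rw [posSemidef_iff_re (hX.1.smul (star_trivial c))]
  intro v
  rw [re_dotProduct_smul_mulVec]
  exact mul_nonneg hc (hX.re_dotProduct_nonneg v)

lemma posDef_smul_real {X : Matrix (Fin n) (Fin n) 𝕜} (hX : X.PosDef) {c : ℝ}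
    (hc : 0 < c) : (c • X).PosDef := by
  rw [posDef_iff_re (hX.1.smul (star_trivial c))]
  intro v hv
  rw [re_dotProduct_smul_mulVec]
  exact mul_pos hc (hX.re_dotProduct_pos hv)

lemma trInner_vecMulVec (X : Matrix (Fin n) (Fin n) 𝕜) (hX : X.IsHermitian) (v : Fin n → 𝕜) :
    trInner X (vecMulVec v (star v)) = RCLike.re (star v ⬝ᵥ (X *ᵥ v)) := by
  rw [trInner, hX.eq, mul_vecMulVec, trace_vecMulVec, dotProduct_comm]

/-- Positivity of the quadratic form need only be tested on the unit sphere; compactness of the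
sphere makes it stable under small changes of the matrix. Openness is what permits strict separation
in `exists_multiplier`. -/
lemma IsHermitianOrthonormalBasis.isOpen_posDef (hΘ : IsHermitianOrthonormalBasis Θ) :
    IsOpen {z : Fin d → ℝ | (ofCoords Θ z).PosDef} := by
  simp only [posDef_iff_re_sphere (hΘ.isHermitian_ofCoords _)]
  rw [isOpen_iff_mem_nhds]
  intro z hz
  refine (isCompact_sphere (0 : Fin n → 𝕜) 1).eventually_forall_of_forall_eventually ?_
  intro v hv
  have hc : Continuous fun q : (Fin d → ℝ) × (Fin n → 𝕜) =>
      RCLike.re (star q.2 ⬝ᵥ (ofCoords Θ q.1 *ᵥ q.2)) := by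
    refine RCLike.continuous_re.comp ?_
    exact Continuous.dotProduct (continuous_snd.star)
      (((continuous_ofCoords Θ).comp continuous_fst).matrix_mulVec continuous_snd)
  exact (hc.tendsto (z, v)).eventually (lt_mem_nhds (hz v hv))

lemma IsHermitianOrthonormalBasis.isClosed_posSemidef (hΘ : IsHermitianOrthonormalBasis Θ)
    (x : Fin d → ℝ) : IsClosed {z : Fin d → ℝ | (ofCoords Θ (x + z)).PosSemidef} := by
  simp only [posSemidef_iff_re (hΘ.isHermitian_ofCoords _), Set.ofPred_forall]
  refine isClosed_iInter fun v => isClosed_le continuous_const (RCLike.continuous_re.comp ?_)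
  exact Continuous.dotProduct continuous_const
    (((continuous_ofCoords Θ).comp (continuous_const.add continuous_id)).matrix_mulVec
      continuous_const)

end Coordinates

/-! ### Separable quadratic minimization over closed convex sets -/

section Optimization

lemma nonneg_of_forall_add_mul_nonneg {a b : ℝ}
    (h : ∀ ε : ℝ, 0 < ε → ε ≤ 1 → 0 ≤ a + ε * b) : 0 ≤ a := by
  have ht : Tendsto (fun ε : ℝ => a + ε * b) (𝓝[>] 0) (𝓝 a) := by
    have : Continuous fun ε : ℝ => a + ε * b := by fun_prop
    simpa using (this.tendsto 0).mono_left nhdsWithin_le_nhds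
  refine ge_of_tendsto ht ?_
  filter_upwards [Ioc_mem_nhdsGT (zero_lt_one' ℝ)] with ε hε using h ε hε.1 hε.2

variable {d : ℕ}

lemma sq_norm_le_sum_sq (z : Fin d → ℝ) : ‖z‖ ^ 2 ≤ ∑ k, z k ^ 2 := by
  have h0 : 0 ≤ ∑ k, z k ^ 2 := Finset.sum_nonneg fun k _ => sq_nonneg _
  have : ‖z‖ ≤ Real.sqrt (∑ k, z k ^ 2) := by
    rw [pi_norm_le_iff_of_nonneg (Real.sqrt_nonneg _)]
    intro k
    rw [Real.norm_eq_abs]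
    exact Real.abs_le_sqrt (Finset.single_le_sum (f := fun k => z k ^ 2)
      (fun k _ => sq_nonneg _) (Finset.mem_univ k))
  calc ‖z‖ ^ 2 ≤ Real.sqrt (∑ k, z k ^ 2) ^ 2 := by gcongr
    _ = _ := Real.sq_sqrt h0

lemma abs_sum_mul_le (b z : Fin d → ℝ) : |∑ k, b k * z k| ≤ (∑ k, |b k|) * ‖z‖ := by
  rw [Finset.sum_mul]
  refine (Finset.abs_sum_le_sum_abs _ _).trans (Finset.sum_le_sum fun k _ => ?_)
  rw [abs_mul]
  exact mul_le_mul_of_nonneg_left (norm_le_pi_norm z k) (abs_nonneg _)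

/-- The separable quadratic function with curvatures `a` and linear part `b`. -/
noncomputable def quadFun (a b z : Fin d → ℝ) : ℝ :=
  ∑ k, a k * z k ^ 2 / 2 + ∑ k, b k * z k

/-- Curvature is required only at nonzero coordinates: fixed coordinates are never sampled and may
have curvature zero, but feasible displacements vanish there. The norm is the sup norm of `Fin d →
ℝ`. -/
lemma mul_sq_norm_le_sum {a z : Fin d → ℝ} {c : ℝ} (hc : 0 < c)
    (haz : ∀ k, z k ≠ 0 → c ≤ a k) : c * ‖z‖ ^ 2 ≤ ∑ k, a k * z k ^ 2 := by
  calc c * ‖z‖ ^ 2 ≤ c * ∑ k, z k ^ 2 := by gcongr; exact sq_norm_le_sum_sq z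
    _ = ∑ k, c * z k ^ 2 := Finset.mul_sum _ _ _
    _ ≤ _ := Finset.sum_le_sum fun k _ => by
      by_cases hz : z k = 0
      · simp [hz]
      · exact mul_le_mul_of_nonneg_right (haz k hz) (sq_nonneg _)

lemma exists_isOptimal_quadFun {S : Set (Fin d → ℝ)} (hS : IsClosed S) (h0 : 0 ∈ S)
    {a b : Fin d → ℝ} {c : ℝ} (hc : 0 < c) (ha : ∀ z ∈ S, ∀ k, z k ≠ 0 → c ≤ a k) :
    ∃ z, IsOptimal S (quadFun a b) z := by
  have hcont : Continuous (quadFun a b) := by unfold quadFun; fun_prop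
  -- Beyond this radius the quadratic part, at least `c ‖x‖² / 2`, dominates the linear part, at
  -- most `(∑ |b k|) ‖x‖`, so values there are at least the value `0` at the origin.
  set R := 2 * (∑ k, |b k|) / c with hR
  have hR0 : 0 ≤ R := by positivity
  obtain ⟨z, ⟨hzS, -⟩, hz⟩ := ((isCompact_closedBall (0 : Fin d → ℝ) R).inter_left hS).exists_isMinOn
    ⟨0, h0, by simpa using hR0⟩ hcont.continuousOn
  refine ⟨z, hzS, fun x hx => ?_⟩
  by_cases hxR : x ∈ Metric.closedBall (0 : Fin d → ℝ) R
  · exact hz ⟨hx, hxR⟩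
  · have hz0 : quadFun a b z ≤ 0 := by
      have : quadFun a b z ≤ quadFun a b 0 := hz ⟨h0, by simpa using hR0⟩
      simpa [quadFun] using this
    refine hz0.trans ?_
    have hxn : R < ‖x‖ := by simpa using hxR
    have h1 := mul_sq_norm_le_sum hc (ha x hx)
    have h2 := neg_le_of_abs_le (abs_sum_mul_le b x)
    have h3 : 2 * (∑ k, |b k|) ≤ c * ‖x‖ := by
      rw [hR, div_lt_iff₀ hc] at hxn
      linarith
    have h4 : 2 * (∑ k, |b k|) * ‖x‖ ≤ c * ‖x‖ * ‖x‖ := by gcongr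
    rw [quadFun, ← Finset.sum_div]
    nlinarith

lemma IsOptimal.quadFun_variational {S : Set (Fin d → ℝ)} (hS : Convex ℝ S) {a b z : Fin d → ℝ}
    (hz : IsOptimal S (quadFun a b) z) {x : Fin d → ℝ} (hx : x ∈ S) :
    0 ≤ ∑ k, (a k * z k + b k) * (x k - z k) := by
  refine nonneg_of_forall_add_mul_nonneg (b := ∑ k, a k * (x k - z k) ^ 2 / 2) fun ε h0 h1 => ?_
  have hmem : z + ε • (x - z) ∈ S := hS.add_smul_sub_mem hz.1 hx ⟨h0.le, h1⟩
  have hle : quadFun a b z ≤ quadFun a b (z + ε • (x - z)) := hz.2 hmem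
  have key : quadFun a b (z + ε • (x - z)) - quadFun a b z =
      ε * (∑ k, (a k * z k + b k) * (x k - z k) + ε * ∑ k, a k * (x k - z k) ^ 2 / 2) := by
    simp only [quadFun, ← Finset.sum_add_distrib, ← Finset.sum_sub_distrib, Finset.mul_sum]
    refine Finset.sum_congr rfl fun k _ => ?_
    simp only [Pi.add_apply, Pi.smul_apply, Pi.sub_apply, smul_eq_mul]
    ring
  have : 0 ≤ ε * (∑ k, (a k * z k + b k) * (x k - z k) + ε * ∑ k, a k * (x k - z k) ^ 2 / 2) := by
    linarith
  exact nonneg_of_mul_nonneg_right this h0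

/-- Testing the variational inequality at `0` gives `∑ a z² ≤ -∑ b z`. The bound is linear in `b`,
so a linear part of order `t` yields a minimizer of order `t`. -/
lemma IsOptimal.norm_le_of_quadFun {S : Set (Fin d → ℝ)} (hS : Convex ℝ S) (h0 : 0 ∈ S)
    {a b z : Fin d → ℝ} {c : ℝ} (hc : 0 < c) (ha : ∀ z ∈ S, ∀ k, z k ≠ 0 → c ≤ a k)
    (hz : IsOptimal S (quadFun a b) z) : ‖z‖ ≤ (∑ k, |b k|) / c := by
  have h1 := hz.quadFun_variational hS h0
  have h2 := mul_sq_norm_le_sum hc (ha z hz.1)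
  have h3 := neg_le_of_abs_le (abs_sum_mul_le b z)
  have h4 : ∑ k, (a k * z k + b k) * ((0 : Fin d → ℝ) k - z k) =
      -(∑ k, a k * z k ^ 2) - ∑ k, b k * z k := by
    rw [← Finset.sum_neg_distrib, ← Finset.sum_sub_distrib]
    refine Finset.sum_congr rfl fun k _ => ?_
    simp only [Pi.zero_apply]
    ring
  rw [le_div_iff₀ hc]
  by_contra! hlt
  have hpos : 0 < ‖z‖ := by
    by_contra! h
    have : ‖z‖ = 0 := le_antisymm h (norm_nonneg _)
    rw [this, zero_mul] at hlt
    exact absurd hlt (not_lt.2 (Finset.sum_nonneg fun k _ => abs_nonneg _))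
  have := mul_lt_mul_of_pos_right hlt hpos
  nlinarith

end Optimization

/-! ### Lagrange multipliers from Slater's condition -/

section Multiplier

variable {𝕜 : Type*} [RCLike 𝕜] {n d : ℕ} {Θ : Fin d → Matrix (Fin n) (Fin n) 𝕜}

/-- The feasible displacements, in coordinates: those `z` that vanish on `α` and for which the
matrix with coordinates `x + z` is positive semidefinite. -/
def feasibleCoords (Θ : Fin d → Matrix (Fin n) (Fin n) 𝕜) (α : Finset (Fin d)) (x : Fin d → ℝ) :
    Set (Fin d → ℝ) :=
  {z | (∀ k ∈ α, z k = 0) ∧ (ofCoords Θ (x + z)).PosSemidef}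

lemma IsHermitianOrthonormalBasis.isClosed_feasibleCoords (hΘ : IsHermitianOrthonormalBasis Θ)
    (α : Finset (Fin d)) (x : Fin d → ℝ) : IsClosed (feasibleCoords Θ α x) := by
  refine IsClosed.inter ?_ (hΘ.isClosed_posSemidef x)
  have : {z : Fin d → ℝ | ∀ k ∈ α, z k = 0} = ⋂ k ∈ α, {z | z k = 0} := by
    ext z
    simp
  change IsClosed {z : Fin d → ℝ | ∀ k ∈ α, z k = 0}
  rw [this]
  exact isClosed_biInter fun k _ => isClosed_eq (continuous_apply k) continuous_const

lemma convex_feasibleCoords (α : Finset (Fin d)) (x : Fin d → ℝ) :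
    Convex ℝ (feasibleCoords Θ α x) := by
  intro y hy z hz s t hs ht hst
  refine ⟨fun k hk => by simp [hy.1 k hk, hz.1 k hk], ?_⟩
  have : x + (s • y + t • z) = s • (x + y) + t • (x + z) := by
    rw [smul_add, smul_add, add_add_add_comm, ← add_smul, hst, one_smul]
  rw [this, ofCoords_add, ofCoords_smul, ofCoords_smul]
  exact (posSemidef_smul_real hy.2 hs).add (posSemidef_smul_real hz.2 ht)

/-- Self-duality of the semidefinite cone: pairing with the rank-one matrices `v vᴴ` recovers the
quadratic form. -/
lemma IsHermitianOrthonormalBasis.posSemidef_of_forall_sum_nonneg (hΘ : IsHermitianOrthonormalBasis Θ)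
    {t : Fin d → ℝ} (ht : ∀ z, (ofCoords Θ z).PosSemidef → 0 ≤ ∑ k, t k * z k) :
    (ofCoords Θ t).PosSemidef := by
  have hT := hΘ.isHermitian_ofCoords t
  rw [posSemidef_iff_re hT]
  intro v
  have hv := posSemidef_vecMulVec_self_star v
  have h := ht (coords Θ (vecMulVec v (star v))) (by rwa [hΘ.ofCoords_coords hv.1])
  rw [← trInner_vecMulVec _ hT v, ← hΘ.ofCoords_coords hv.1, trInner_ofCoords,
    hΘ.coords_ofCoords]
  exact h

/-- Conic duality under the Slater condition. -/
theorem IsHermitianOrthonormalBasis.exists_multiplier (hΘ : IsHermitianOrthonormalBasis Θ)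
    {α : Finset (Fin d)} {x x0 g : Fin d → ℝ} (hx : (ofCoords Θ x).PosSemidef)
    (hx0 : (ofCoords Θ x0).PosDef) (hα : ∀ k ∈ α, x0 k = x k)
    (hg : ∀ z ∈ feasibleCoords Θ α x, 0 ≤ ∑ k, g k * z k) :
    ∃ t : Fin d → ℝ, (ofCoords Θ t).PosSemidef ∧ ∑ k, t k * x k = 0 ∧ ∀ k ∉ α, t k = g k := by
  have hsingle : ∀ (t : Fin d → ℝ) k, ∑ i, t i * (Pi.single k (1 : ℝ) : Fin d → ℝ) i = t k := by
    intro t k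
    simp [Pi.single_apply]
  have hvan : ∀ k, k ∉ α → ∀ i ∈ α, (Pi.single k (1 : ℝ) : Fin d → ℝ) i = 0 := by
    intro k hk i hi
    rw [Pi.single_apply, if_neg]
    rintro rfl
    exact hk hi
  set G : (Fin d → ℝ) →ₗ[ℝ] ℝ :=
    { toFun := fun z => ∑ k, g k * z k
      map_add' := fun z z' => by simp [mul_add, Finset.sum_add_distrib]
      map_smul' := fun c z => by
        simp only [Pi.smul_apply, smul_eq_mul, RingHom.id_apply, Finset.mul_sum]
        exact Finset.sum_congr rfl fun k _ => by ring } with hG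
  have hGz : ∀ z, G z = ∑ k, g k * z k := fun z => rfl
  by_cases hneg : ∃ h : Fin d → ℝ, (∀ k ∈ α, h k = 0) ∧ G h < 0
  swap
  -- Degenerate case: `G` is nonnegative on a linear subspace, hence zero there, and the zero
  -- multiplier works.
  · push Not at hneg
    refine ⟨0, by rw [ofCoords_zero]; exact .zero, by simp, fun k hk => ?_⟩
    have h1 := hneg (Pi.single k 1) (hvan k hk)
    have h2 := hneg (-Pi.single k 1) (fun i hi => by rw [Pi.neg_apply, hvan k hk i hi, neg_zero])
    rw [map_neg] at h2
    rw [hGz, hsingle] at h1 h2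
    simp only [Pi.zero_apply]
    linarith
  obtain ⟨h0, h0α, h0neg⟩ := hneg
  -- A positive definite point in the second set would be a feasible displacement along which `g` is
  -- negative. The multiplier is the separating functional `f` of these two convex sets, rescaled.
  have hdisj : Disjoint {z : Fin d → ℝ | (ofCoords Θ z).PosDef}
      {z | (∀ k ∈ α, z k - x k = 0) ∧ G (z - x) < 0} := by
    rw [Set.disjoint_left]
    intro z hz hz'
    refine absurd (hg (z - x) ⟨fun k hk => hz'.1 k hk, ?_⟩) (not_le.2 hz'.2)
    rw [add_sub_cancel]
    exact hz.posSemidef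
  obtain ⟨f, u, hf1, hf2⟩ := geometric_hahn_banach_open
    (s := {z : Fin d → ℝ | (ofCoords Θ z).PosDef})
    (t := {z | (∀ k ∈ α, z k - x k = 0) ∧ G (z - x) < 0}) (by
      intro y hy z hz s t hs ht hst
      rw [Set.mem_ofPred_eq, ofCoords_add, ofCoords_smul, ofCoords_smul]
      rcases hs.eq_or_lt with rfl | hs
      · rw [zero_add] at hst
        simpa [hst] using hz
      · exact (posDef_smul_real hy hs).add_posSemidef (posSemidef_smul_real hz.posSemidef ht))
    hΘ.isOpen_posDef (by
      intro y hy z hz s t hs ht hst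
      have : s • y + t • z - x = s • (y - x) + t • (z - x) := by
        rw [smul_sub, smul_sub, sub_add_sub_comm, ← add_smul, hst, one_smul]
      refine ⟨fun k hk => ?_, ?_⟩
      · have h := congrFun this k
        simp only [Pi.sub_apply, Pi.add_apply, Pi.smul_apply, hy.1 k hk, hz.1 k hk] at h
        simpa using h
      · rw [this, map_add, map_smul, map_smul, smul_eq_mul, smul_eq_mul]
        rcases hs.eq_or_lt with rfl | hs
        · rw [zero_add] at hst
          simpa [hst] using hz.2
        · have h1 := mul_neg_of_pos_of_neg hs hy.2
          have h2 := mul_nonpos_of_nonneg_of_nonpos ht hz.2.le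
          linarith) hdisj
  simp only [Set.mem_ofPred_eq] at hf1 hf2
  have hscale : ∀ z, (ofCoords Θ z).PosDef → ∀ s : ℝ, 0 < s → s * f z < u := by
    intro z hz s hs
    have := hf1 (s • z) (by rw [ofCoords_smul]; exact posDef_smul_real hz hs)
    simpa using this
  have hu0 : 0 ≤ u := nonneg_of_forall_add_mul_nonneg (b := -f x0) fun ε h _ => by
    have := hscale x0 hx0 ε h
    linarith
  have hPD : ∀ z, (ofCoords Θ z).PosDef → f z ≤ 0 := by
    intro z hz
    by_contra! hpos
    have := hscale z hz ((u + 1) / f z) (by positivity)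
    rw [div_mul_cancel₀ _ hpos.ne'] at this
    linarith
  have hPSD : ∀ z, (ofCoords Θ z).PosSemidef → f z ≤ 0 := by
    intro z hz
    have : 0 ≤ -f z := nonneg_of_forall_add_mul_nonneg (b := -f x0) fun ε h _ => by
      have := hPD (z + ε • x0) (by
        rw [ofCoords_add, ofCoords_smul]
        exact (posDef_smul_real hx0 h).posSemidef_add hz)
      simp only [map_add, map_smul, smul_eq_mul] at this
      linarith
    linarith
  have hdir : ∀ h : Fin d → ℝ, (∀ k ∈ α, h k = 0) → G h < 0 → ∀ s : ℝ, 0 < s →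
      u ≤ f x + s * f h := by
    intro h hα hneg s hs
    have := hf2 (x + s • h) ⟨fun k hk => by simp [hα k hk], by
      rw [add_sub_cancel_left, map_smul, smul_eq_mul]
      exact mul_neg_of_pos_of_neg hs hneg⟩
    simpa using this
  have hux : 0 ≤ f x - u := nonneg_of_forall_add_mul_nonneg (b := f h0) fun ε h _ => by
    have := hdir h0 h0α h0neg ε h
    linarith
  -- Here `u ≤ f x` comes from approaching `x` along `h0`, `f x ≤ 0` from `x` lying in the closed
  -- cone, and `0 ≤ u` from scaling `x0` to zero.
  have hfx : f x = 0 := le_antisymm (hPSD x hx) (by linarith)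
  have hu : u = 0 := by linarith
  have hfneg : ∀ h : Fin d → ℝ, (∀ k ∈ α, h k = 0) → G h < 0 → 0 ≤ f h := by
    intro h h1 h2
    have := hdir h h1 h2 1 one_pos
    linarith
  have hker : ∀ h : Fin d → ℝ, (∀ k ∈ α, h k = 0) → G h = 0 → 0 ≤ f h := by
    intro h h1 h2
    refine nonneg_of_forall_add_mul_nonneg (b := f h0) fun ε hε _ => ?_
    have := hfneg (h + ε • h0) (fun k hk => by simp [h1 k hk, h0α k hk]) (by
      rw [map_add, h2, map_smul, smul_eq_mul, zero_add]
      exact mul_neg_of_pos_of_neg hε h0neg)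
    simpa using this
  -- Among directions vanishing on `α`, `f` vanishes wherever `G` does, so it is a multiple of `G`.
  have hprop : ∀ h : Fin d → ℝ, (∀ k ∈ α, h k = 0) → f h = f h0 / G h0 * G h := by
    intro h h1
    have hz : G (h - (G h / G h0) • h0) = 0 := by
      rw [map_sub, map_smul, smul_eq_mul, div_mul_cancel₀ _ h0neg.ne, sub_self]
    have hα' : ∀ k ∈ α, (h - (G h / G h0) • h0) k = 0 := fun k hk => by simp [h1 k hk, h0α k hk]
    have e1 := hker _ hα' hz
    have e2 := hker (-(h - (G h / G h0) • h0))
      (fun k hk => by rw [Pi.neg_apply, hα' k hk, neg_zero]) (by rw [map_neg, hz, neg_zero])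
    rw [map_neg] at e2
    simp only [map_sub, map_smul, smul_eq_mul] at e1 e2
    have : f h = G h / G h0 * f h0 := by linarith
    rw [this]
    ring
  set c := f h0 / G h0 with hc
  -- Slater's condition excludes `c = 0`: otherwise `f x0 = f x = 0`, whereas `f` is strictly
  -- negative at the positive definite `x0`.
  have hc0 : c < 0 := by
    have hle : c ≤ 0 := div_nonpos_of_nonneg_of_nonpos (hfneg h0 h0α h0neg) h0neg.le
    refine lt_of_le_of_ne hle fun hcz => ?_
    have h1 := hprop (x0 - x) (fun k hk => by rw [Pi.sub_apply, hα k hk, sub_self])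
    rw [hcz, zero_mul, map_sub, hfx, sub_zero] at h1
    have := hf1 x0 hx0
    linarith
  have hfsum : ∀ z, ∑ k, f (Pi.single k 1) / c * z k = f z / c := by
    intro z
    conv_rhs => rw [← Finset.univ_sum_single z, map_sum, Finset.sum_div]
    refine Finset.sum_congr rfl fun k _ => ?_
    have : (Pi.single k (z k) : Fin d → ℝ) = z k • Pi.single k 1 := by
      rw [← Pi.single_smul, smul_eq_mul, mul_one]
    rw [this, map_smul, smul_eq_mul]
    ring
  refine ⟨fun k => f (Pi.single k 1) / c, hΘ.posSemidef_of_forall_sum_nonneg fun z hz => ?_, ?_,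
    fun k hk => ?_⟩
  · rw [hfsum]
    exact div_nonneg_of_nonpos (hPSD z hz) hc0.le
  · rw [hfsum, hfx, zero_div]
  · beta_reduce
    rw [hprop _ (hvan k hk), mul_div_cancel_left₀ _ hc0.ne, hGz, hsingle]

end Multiplier

/-! ### Eigenvector blocks, rank and kernel -/

section Blocks

variable {𝕜 : Type*} [RCLike 𝕜] {n : ℕ}

/-- The position of the `j`-th of the last `n - r` indices. -/
def lastIdx (r : ℕ) (j : Fin (n - r)) : Fin n :=
  ⟨r + j.1, by have := j.2; omega⟩

lemma lastCols_mul_mul (r : ℕ) (P X : Matrix (Fin n) (Fin n) 𝕜) :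
    (lastCols r P)ᴴ * X * lastCols r P = (Pᴴ * X * P).submatrix (lastIdx r) (lastIdx r) := by
  ext i j
  simp [Matrix.mul_apply, lastCols, lastIdx]

/-- A decreasing diagonal factor of a matrix of rank `r` vanishes exactly from position `r` on. -/
lemma diag_ne_zero_iff_lt_rank {P X : Matrix (Fin n) (Fin n) 𝕜} {l : Fin n → ℝ}
    (hP : P ∈ Matrix.unitaryGroup (Fin n) 𝕜) (hl : Antitone fun i => |l i|)
    (hX : X = P * realDiag 𝕜 l * Pᴴ) (i : Fin n) : l i ≠ 0 ↔ i.1 < X.rank := by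
  classical
  have hdet : IsUnit P.det := UnitaryGroup.det_isUnit ⟨P, hP⟩
  have hdet' : IsUnit Pᴴ.det := by rw [det_conjTranspose]; exact hdet.star
  have hr : X.rank = Fintype.card {i // l i ≠ 0} := by
    rw [hX, rank_mul_eq_left_of_isUnit_det _ _ hdet', rank_mul_eq_right_of_isUnit_det _ _ hdet,
      realDiag, rank_diagonal]
    simp
  rw [Fintype.card_subtype] at hr
  have hmono : ∀ {j k : Fin n}, j ≤ k → l k ≠ 0 → l j ≠ 0 := by
    intro j k hjk hk hj
    have := hl hjk
    simp only [hj, abs_zero] at this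
    exact hk (abs_nonpos_iff.1 this)
  constructor
  · intro hi
    have hsub : Finset.Iic i ⊆ Finset.univ.filter fun j => l j ≠ 0 := by
      intro j hj
      simpa using hmono (Finset.mem_Iic.1 hj) hi
    have := Finset.card_le_card hsub
    rw [Fin.card_Iic] at this
    omega
  · intro hi h0
    have hsub : (Finset.univ.filter fun j => l j ≠ 0) ⊆ Finset.Iio i := by
      intro j hj
      rw [Finset.mem_Iio]
      by_contra! hij
      exact hmono hij (by simpa using hj) h0
    have := Finset.card_le_card hsub
    rw [Fin.card_Iio] at this
    omega

lemma conj_eq_of_eq_conj {P X D : Matrix (Fin n) (Fin n) 𝕜}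
    (hP : P ∈ Matrix.unitaryGroup (Fin n) 𝕜) (hX : X = P * D * Pᴴ) : Pᴴ * X * P = D := by
  have h : Pᴴ * P = 1 := mem_unitaryGroup_iff'.1 hP
  rw [hX]
  calc Pᴴ * (P * D * Pᴴ) * P = (Pᴴ * P) * D * (Pᴴ * P) := by simp only [Matrix.mul_assoc]
    _ = D := by rw [h, Matrix.one_mul, Matrix.mul_one]

lemma eq_conj_conj {P : Matrix (Fin n) (Fin n) 𝕜} (hP : P ∈ Matrix.unitaryGroup (Fin n) 𝕜)
    (X : Matrix (Fin n) (Fin n) 𝕜) : X = P * (Pᴴ * X * P) * Pᴴ := by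
  have h : P * Pᴴ = 1 := mem_unitaryGroup_iff.1 hP
  calc X = (P * Pᴴ) * X * (P * Pᴴ) := by rw [h, Matrix.one_mul, Matrix.mul_one]
    _ = _ := by simp only [Matrix.mul_assoc]

lemma det_submatrix_eq_zero_of_rank_lt {ι : Type*} [Fintype ι] [DecidableEq ι]
    (A : Matrix (Fin n) (Fin n) 𝕜) (e e' : ι → Fin n) (h : A.rank < Fintype.card ι) :
    (A.submatrix e e').det = 0 := by
  by_contra hdet
  have h1 := rank_of_isUnit _ ((isUnit_iff_isUnit_det _).2 (isUnit_iff_ne_zero.2 hdet))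
  have h2 := rank_submatrix_le A e e'
  omega

/-- First-order form of the constancy of the rank: along matrices `X + t Δ` of rank `r`, the limit
of the directions `Δ` vanishes on the kernel of `X`. -/
theorem lastCols_conj_eq_zero_of_rank_eq {X D : Matrix (Fin n) (Fin n) 𝕜}
    {P : Matrix (Fin n) (Fin n) 𝕜} (hP : P ∈ orderedEigenbases X)
    {t : ℕ → ℝ} (ht : ∀ i, t i ≠ 0) (ht0 : Tendsto t atTop (𝓝 0))
    {Δ : ℕ → Matrix (Fin n) (Fin n) 𝕜} (hΔ : Tendsto Δ atTop (𝓝 D))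
    (hrank : ∀ i, (X + t i • Δ i).rank = X.rank) :
    (lastCols X.rank P)ᴴ * D * lastCols X.rank P = 0 := by
  obtain ⟨hPu, l, hl, hX⟩ := hP
  have hne := diag_ne_zero_iff_lt_rank hPu hl hX
  have hD := conj_eq_of_eq_conj hPu hX
  have hdet : IsUnit P.det := UnitaryGroup.det_isUnit ⟨P, hPu⟩
  have hdet' : IsUnit Pᴴ.det := by rw [det_conjTranspose]; exact hdet.star
  have hrn : X.rank ≤ n := by simpa using rank_le_height X
  set r := X.rank with hr
  rw [lastCols_mul_mul]
  ext j k
  rw [submatrix_apply, Matrix.zero_apply]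
  set a : Fin r → Fin n := Fin.castLE hrn
  set Y : ℕ → Matrix (Fin n) (Fin n) 𝕜 := fun i => Pᴴ * Δ i * P with hY
  have hYlim : Tendsto Y atTop (𝓝 (Pᴴ * D * P)) := by
    have : Continuous fun Z : Matrix (Fin n) (Fin n) 𝕜 => Pᴴ * Z * P := by fun_prop
    exact (this.tendsto D).comp hΔ
  have hYe : ∀ b c : Fin n, Tendsto (fun i => Y i b c) atTop (𝓝 ((Pᴴ * D * P) b c)) := fun b c =>
    ((continuous_id.matrix_elem b c).tendsto _).comp hYlim
  have hconj : ∀ i, Pᴴ * (X + t i • Δ i) * P = realDiag 𝕜 l + t i • Y i := by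
    intro i
    rw [Matrix.mul_add, Matrix.add_mul, hD, Matrix.mul_smul, Matrix.smul_mul]
  -- The minor of the conjugated matrix on the first `r` indices bordered by row `r + j` and column
  -- `r + k`, with its last row divided by `t i`. It has size `r + 1`, so rank `r` makes it
  -- singular; its limit is block triangular with determinant `(∏ l) * (Pᴴ D P)_{jk}`, and the
  -- product is nonzero.
  set N : ℕ → Matrix (Fin r ⊕ Unit) (Fin r ⊕ Unit) 𝕜 := fun i =>
    fromBlocks ((realDiag 𝕜 l + t i • Y i).submatrix a a)
      (Matrix.of fun b _ => (t i : 𝕜) * Y i (a b) (lastIdx r k))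
      (Matrix.of fun _ c => Y i (lastIdx r j) (a c))
      (Matrix.of fun _ _ => Y i (lastIdx r j) (lastIdx r k)) with hN
  have hlast : ∀ j : Fin (n - r), l (lastIdx r j) = 0 := fun j => by
    by_contra h
    have := (hne _).1 h
    simp [lastIdx] at this
  have hal : ∀ b : Fin r, a b ≠ lastIdx r j ∧ a b ≠ lastIdx r k := fun b => by
    have := b.2
    constructor <;> (intro h; have := congrArg Fin.val h; simp [a, lastIdx] at this; omega)
  have hN0 : ∀ i, (N i).det = 0 := by
    intro i
    have h1 : ((realDiag 𝕜 l + t i • Y i).submatrix (Sum.elim a fun _ : Unit => lastIdx r j)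
        (Sum.elim a fun _ : Unit => lastIdx r k)).det = 0 := by
      refine det_submatrix_eq_zero_of_rank_lt _ _ _ ?_
      rw [← hconj, rank_mul_eq_left_of_isUnit_det _ _ hdet, rank_mul_eq_right_of_isUnit_det _ _ hdet',
        hrank]
      simp
    have h2 : (realDiag 𝕜 l + t i • Y i).submatrix (Sum.elim a fun _ : Unit => lastIdx r j)
        (Sum.elim a fun _ : Unit => lastIdx r k) =
        diagonal (Sum.elim (fun _ => 1) fun _ => (t i : 𝕜)) * N i := by
      ext b c
      rw [diagonal_mul]
      rcases b with b | b <;> rcases c with c | c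
      · simp [hN]
      · simp [hN, realDiag, diagonal_apply_ne _ (hal b).2, RCLike.real_smul_eq_coe_mul]
      · simp [hN, realDiag, diagonal_apply_ne _ (hal c).1.symm, RCLike.real_smul_eq_coe_mul]
      · have : realDiag 𝕜 l (lastIdx r j) (lastIdx r k) = 0 := by
          by_cases hjk : lastIdx r j = lastIdx r k
          · simp [realDiag, hjk, hlast]
          · exact diagonal_apply_ne _ hjk
        simp [hN, this, RCLike.real_smul_eq_coe_mul]
    rw [h2, det_mul, det_diagonal] at h1
    refine (mul_eq_zero.1 h1).resolve_left ?_
    simp [ht i]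
  have htc : Tendsto (fun i => (t i : 𝕜)) atTop (𝓝 0) := by
    simpa [Function.comp_def] using ((RCLike.continuous_ofReal (K := 𝕜)).tendsto 0).comp ht0
  have hNlim : Tendsto N atTop (𝓝 (fromBlocks (diagonal fun b => (l (a b) : 𝕜)) 0
      (Matrix.of fun _ c => (Pᴴ * D * P) (lastIdx r j) (a c))
      (Matrix.of fun _ _ => (Pᴴ * D * P) (lastIdx r j) (lastIdx r k)))) := by
    refine tendsto_pi_nhds.2 fun b => tendsto_pi_nhds.2 fun c => ?_
    rcases b with b | b <;> rcases c with c | c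
    · have h := (htc.mul (hYe (a b) (a c))).const_add (realDiag 𝕜 l (a b) (a c))
      have e : (diagonal fun b => (l (a b) : 𝕜)) b c = realDiag 𝕜 l (a b) (a c) := by
        by_cases hbc : b = c
        · simp [hbc, realDiag]
        · have : a b ≠ a c := fun h => hbc (Fin.castLE_injective hrn h)
          rw [diagonal_apply_ne _ hbc, realDiag, diagonal_apply_ne _ this]
      simpa [hN, e, RCLike.real_smul_eq_coe_mul] using h
    · have h := htc.mul (hYe (a b) (lastIdx r k))
      simpa [hN] using h
    · simpa [hN] using hYe (lastIdx r j) (a c)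
    · simpa [hN] using hYe (lastIdx r j) (lastIdx r k)
  have hdlim := ((continuous_id.matrix_det).tendsto _).comp hNlim
  have hz : Tendsto (fun i => (N i).det) atTop (𝓝 0) := by simp [hN0]
  have := tendsto_nhds_unique hdlim hz
  rw [id, det_fromBlocks_zero₁₂, det_diagonal, det_unique (n := Unit)] at this
  refine (mul_eq_zero.1 this).resolve_left ?_
  refine Finset.prod_ne_zero_iff.2 fun b _ => ?_
  have := (hne (a b)).2 b.2
  exact_mod_cast this

/-- A positive semidefinite matrix orthogonal to a positive semidefinite `X` lives on the kernel
of `X`. -/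
theorem eq_lastCols_conj_of_trInner_eq_zero {X T P : Matrix (Fin n) (Fin n) 𝕜}
    (hX : X.PosSemidef) (hT : T.PosSemidef) (hXT : trInner T X = 0)
    (hP : P ∈ orderedEigenbases X) :
    T = lastCols X.rank P * ((lastCols X.rank P)ᴴ * T * lastCols X.rank P) *
      (lastCols X.rank P)ᴴ := by
  obtain ⟨hPu, l, hl, hXP⟩ := hP
  have hne := diag_ne_zero_iff_lt_rank hPu hl hXP
  have hD := conj_eq_of_eq_conj hPu hXP
  set r := X.rank with hr
  have hl0 : ∀ i, 0 ≤ l i := by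
    have h := hX.conjTranspose_mul_mul_same P
    rw [hD, realDiag, posSemidef_diagonal_iff] at h
    intro i
    exact_mod_cast h i
  have hS := hT.conjTranspose_mul_mul_same P
  set S := Pᴴ * T * P with hSdef
  have hTS : T = P * S * Pᴴ := eq_conj_conj hPu T
  have htr : ∑ i, RCLike.re (S i i) * l i = 0 := by
    have h1 : trInner T X = RCLike.re (S * realDiag 𝕜 l).trace := by
      rw [trInner, hT.1.eq, hXP, hSdef, ← Matrix.mul_assoc, Matrix.trace_mul_comm]
      simp only [Matrix.mul_assoc]
    rw [h1, realDiag, Matrix.trace] at hXT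
    rw [← hXT, map_sum]
    refine Finset.sum_congr rfl fun i _ => ?_
    rw [diag_apply, mul_diagonal, RCLike.re_mul_ofReal]
  have hSii : ∀ i, 0 ≤ RCLike.re (S i i) := fun i => (RCLike.nonneg_iff.1 hS.diag_nonneg).1
  -- A vanishing sum of products of nonnegative numbers, where the first `r` eigenvalues are
  -- nonzero. For a semidefinite matrix, a zero diagonal entry then annihilates its whole row and
  -- column.
  have hzero : ∀ i : Fin n, i.1 < r → S i i = 0 := by
    intro i hi
    have h1 := (Finset.sum_eq_zero_iff_of_nonneg
      fun i _ => mul_nonneg (hSii i) (hl0 i)).1 htr i (Finset.mem_univ i)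
    have h2 := (mul_eq_zero.1 h1).resolve_right ((hne i).2 hi)
    have h3 := (RCLike.nonneg_iff.1 (hS.diag_nonneg (i := i))).2
    exact RCLike.ext (by simpa using h2) (by simpa using h3)
  have hcol : ∀ i j : Fin n, i.1 < r → S j i = 0 := by
    intro i j hi
    have h := (hS.dotProduct_mulVec_zero_iff (Pi.single i 1)).1 (by simpa using hzero i hi)
    have := congrFun h j
    simpa using this
  have hrow : ∀ i j : Fin n, i.1 < r → S i j = 0 := by
    intro i j hi
    rw [← hS.1.apply i j, hcol i j hi, star_zero]
  rw [lastCols_mul_mul, ← hSdef]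
  conv_lhs => rw [hTS]
  have hsum : ∀ g : Fin n → 𝕜, (∀ i : Fin n, i.1 < r → g i = 0) →
      ∑ i, g i = ∑ j : Fin (n - r), g (lastIdx r j) := by
    intro g hg
    have hinj : Function.Injective (lastIdx r : Fin (n - r) → Fin n) := by
      intro a b hab
      have := congrArg Fin.val hab
      simp only [lastIdx] at this
      exact Fin.ext (by omega)
    rw [← Finset.sum_image (s := Finset.univ) (g := lastIdx r) (f := g) (fun a _ b _ h => hinj h)]
    refine (Finset.sum_subset (Finset.subset_univ _) fun i _ hi => hg i ?_).symm
    by_contra! hri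
    exact hi (Finset.mem_image.2 ⟨⟨i.1 - r, by have := i.2; omega⟩, Finset.mem_univ _,
      Fin.ext (by simp only [lastIdx]; omega)⟩)
  ext i j
  rw [Matrix.mul_apply, Matrix.mul_apply, hsum _ fun c hc => ?_]
  · refine Finset.sum_congr rfl fun c _ => ?_
    rw [Matrix.mul_apply, Matrix.mul_apply, hsum _ fun b hb => ?_]
    · simp [lastCols, lastIdx]
    · rw [hrow _ _ hb, mul_zero]
  · rw [Matrix.mul_apply, Finset.sum_eq_zero fun b _ => by rw [hcol _ _ hc, mul_zero], zero_mul]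

end Blocks

/-! ### Limit of the scaled errors -/

section Limit

variable {𝕜 : Type*} [RCLike 𝕜] {n d : ℕ} {Θ : Fin d → Matrix (Fin n) (Fin n) 𝕜}

/-- If the scaled errors `u` of a solution sequence have a limit that satisfies the optimality
conditions at `X` and vanishes on the kernel of `X`, then the linear system is solvable. -/
lemma IsHermitianOrthonormalBasis.exists_solution_of_limit (hΘ : IsHermitianOrthonormalBasis Θ)
    {α : Finset (Fin d)} {X X0 M P : Matrix (Fin n) (Fin n) 𝕜} (hX : X.PosSemidef)
    (hX0 : X0.PosDef) (hα : ∀ k ∈ α, coords Θ X0 k = coords Θ X k)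
    (hP : P ∈ orderedEigenbases X) {p u : Fin d → ℝ} (hp : ∀ k ∉ α, 0 < p k)
    (hu : ∀ k ∈ α, u k = 0)
    (hvar : ∀ z ∈ feasibleCoords Θ α (coords Θ X), 0 ≤ ∑ k, (p k * u k + coords Θ M k) * z k)
    (hker : (lastCols X.rank P)ᴴ * ofCoords Θ u * lastCols X.rank P = 0) :
    ∃ L : Matrix (Fin (n - X.rank)) (Fin (n - X.rank)) 𝕜, L.PosSemidef ∧
      (lastCols X.rank P)ᴴ *
          Qdag Θ αᶜ p (lastCols X.rank P * L * (lastCols X.rank P)ᴴ) * lastCols X.rank P =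
        (lastCols X.rank P)ᴴ * Qdag Θ αᶜ p M * lastCols X.rank P := by
  obtain ⟨t, ht, htX, htg⟩ := hΘ.exists_multiplier (x := coords Θ X) (x0 := coords Θ X0)
    (by rwa [hΘ.ofCoords_coords hX.1]) (by rwa [hΘ.ofCoords_coords hX0.1]) hα hvar
  refine ⟨_, ht.conjTranspose_mul_mul_same (lastCols X.rank P), ?_⟩
  have hTX : trInner (ofCoords Θ t) X = 0 := by
    rw [← hΘ.ofCoords_coords hX.1, trInner_ofCoords, hΘ.coords_ofCoords, htX]
  rw [← eq_lastCols_conj_of_trInner_eq_zero hX ht hTX hP]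
  -- Off `α` the multiplier has coordinates `p k * u k + ⟨Θ k, M⟩`; division by `p k` separates the
  -- limiting error, which the compression by `P₂` kills.
  have hdiff : Qdag Θ αᶜ p (ofCoords Θ t) = ofCoords Θ u + Qdag Θ αᶜ p M := by
    have hu' : ofCoords Θ u = ∑ k ∈ αᶜ, u k • Θ k := by
      rw [ofCoords]
      refine (Finset.sum_subset (Finset.subset_univ _) fun k _ hk => ?_).symm
      rw [hu k (by simpa using hk), zero_smul]
    rw [hu', Qdag, Qdag, ← Finset.sum_add_distrib]
    refine Finset.sum_congr rfl fun k hk => ?_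
    have hk' : k ∉ α := by simpa using hk
    rw [← add_smul]
    congr 1
    have h1 : trInner (Θ k) (ofCoords Θ t) = t k := congrFun (hΘ.coords_ofCoords t) k
    rw [h1, htg k hk', coords]
    have := (hp k hk').ne'
    field_simp
  rw [hdiff, Matrix.mul_add, Matrix.add_mul, hker, zero_add]

/-- The linear system is solvable as soon as one sequence of minimizers, with vanishing
perturbations, has constant rank. -/
theorem IsHermitianOrthonormalBasis.exists_solution_of_seq (hΘ : IsHermitianOrthonormalBasis Θ)
    {α : Finset (Fin d)} {X X0 M P : Matrix (Fin n) (Fin n) 𝕜} (hX : X.PosSemidef)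
    (hX0 : X0.PosDef) (hα : ∀ k ∈ α, coords Θ X0 k = coords Θ X k)
    (hP : P ∈ orderedEigenbases X) {p : Fin d → ℝ} (hp : ∀ k ∉ α, 0 < p k)
    {t γ : ℕ → ℝ} {q N h e z : ℕ → Fin d → ℝ} {c C : ℝ} (hc : 0 < c)
    (ht : ∀ i, 0 < t i) (ht0 : Tendsto t atTop (𝓝 0)) (hγ0 : ∀ i, 0 ≤ γ i) (hγC : ∀ i, γ i ≤ C)
    (hq : Tendsto q atTop (𝓝 p)) (hqc : ∀ i, ∀ k ∉ α, c ≤ q i k)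
    (hN : ∀ k, Tendsto (fun i => N i k / t i) atTop (𝓝 0))
    (hh : Tendsto h atTop (𝓝 (coords Θ M))) (he : Tendsto e atTop (𝓝 0))
    (hz : ∀ i, IsOptimal (feasibleCoords Θ α (coords Θ X))
      (quadFun (fun k => q i k + t i * γ i) fun k => t i * (h i k + γ i * e i k) - N i k) (z i))
    (hrank : ∀ i, (ofCoords Θ (coords Θ X + z i)).rank = X.rank) :
    ∃ L : Matrix (Fin (n - X.rank)) (Fin (n - X.rank)) 𝕜, L.PosSemidef ∧
      (lastCols X.rank P)ᴴ *
          Qdag Θ αᶜ p (lastCols X.rank P * L * (lastCols X.rank P)ᴴ) * lastCols X.rank P =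
        (lastCols X.rank P)ᴴ * Qdag Θ αᶜ p M * lastCols X.rank P := by
  have hconv := convex_feasibleCoords (Θ := Θ) α (coords Θ X)
  have h0 : (0 : Fin d → ℝ) ∈ feasibleCoords Θ α (coords Θ X) :=
    ⟨fun _ _ => rfl, by rwa [add_zero, hΘ.ofCoords_coords hX.1]⟩
  -- The linear part of the problem divided by `t i`; the noise and the bounded multiple of `e`
  -- disappear in its limit.
  set v : ℕ → Fin d → ℝ := fun i k => h i k + γ i * e i k - N i k / t i with hv
  have hvlim : Tendsto v atTop (𝓝 (coords Θ M)) := by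
    rw [tendsto_pi_nhds] at hh he ⊢
    intro k
    have h1 : Tendsto (fun i => γ i * e i k) atTop (𝓝 0) := by
      have hb : Tendsto (fun i => C * |e i k|) atTop (𝓝 0) := by
        simpa using ((he k).abs.const_mul C)
      refine squeeze_zero_norm (fun i => ?_) hb
      rw [norm_mul, Real.norm_eq_abs, Real.norm_eq_abs, abs_of_nonneg (hγ0 i)]
      exact mul_le_mul_of_nonneg_right (hγC i) (abs_nonneg _)
    simpa [hv] using ((hh k).add h1).sub (hN k)
  set u : ℕ → Fin d → ℝ := fun i => (t i)⁻¹ • z i with hu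
  have hzu : ∀ i, z i = t i • u i := fun i => by
    rw [hu, smul_smul, mul_inv_cancel₀ (ht i).ne', one_smul]
  have hbv : ∀ i k, t i * (h i k + γ i * e i k) - N i k = t i * v i k := fun i k => by
    have := (ht i).ne'
    simp only [hv]
    field_simp
  have hsum : Tendsto (fun i => (∑ k, |v i k|) / c) atTop (𝓝 ((∑ k, |coords Θ M k|) / c)) := by
    refine Tendsto.div_const (tendsto_finsetSum _ fun k _ => ?_) c
    exact ((tendsto_pi_nhds.1 hvlim) k).abs
  obtain ⟨B, hB⟩ := hsum.bddAbove_range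
  have hubound : ∀ i, u i ∈ Metric.closedBall (0 : Fin d → ℝ) B := by
    intro i
    have h1 := (hz i).norm_le_of_quadFun hconv h0 hc (fun x hx k hk => by
      have hkα : k ∉ α := fun hkα => hk (hx.1 k hkα)
      exact (hqc i k hkα).trans (le_add_of_nonneg_right (mul_nonneg (ht i).le (hγ0 i))))
    simp only [hbv, abs_mul, abs_of_pos (ht i), ← Finset.mul_sum] at h1
    rw [hzu i, norm_smul, Real.norm_eq_abs, abs_of_pos (ht i), mul_div_assoc] at h1
    rw [mem_closedBall_zero_iff]
    exact (le_of_mul_le_mul_left h1 (ht i)).trans (hB (Set.mem_range_self i))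
  obtain ⟨u₀, -, φ, hφ, hulim⟩ := tendsto_subseq_of_bounded Metric.isBounded_closedBall hubound
  have hφt := hφ.tendsto_atTop
  have hzα : ∀ i, ∀ k ∈ α, u i k = 0 := fun i k hk => by
    simp [hu, (hz i).1.1 k hk]
  have hulim' := tendsto_pi_nhds.1 hulim
  have htγ : Tendsto (fun i => t i * γ i) atTop (𝓝 0) := by
    have hb : Tendsto (fun i => t i * C) atTop (𝓝 0) := by simpa using ht0.mul_const C
    exact squeeze_zero (fun i => mul_nonneg (ht i).le (hγ0 i))
      (fun i => mul_le_mul_of_nonneg_left (hγC i) (ht i).le) hb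
  refine hΘ.exists_solution_of_limit (u := u₀) hX hX0 hα hP hp ?_ ?_ ?_
  · intro k hk
    refine tendsto_nhds_unique (hulim' k) ?_
    simp [hzα _ k hk]
  · intro x hx
    -- The variational inequality divided by `t i`. The test displacement `x` stays unscaled, so in
    -- the limit it is measured from `X` itself.
    have hnonneg : ∀ i, 0 ≤ ∑ k, ((q i k + t i * γ i) * u i k + v i k) * (x k - t i * u i k) := by
      intro i
      have h1 := (hz i).quadFun_variational hconv hx
      have h2 : ∑ k, ((q i k + t i * γ i) * z i k + (t i * (h i k + γ i * e i k) - N i k)) *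
          (x k - z i k) =
          t i * ∑ k, ((q i k + t i * γ i) * u i k + v i k) * (x k - t i * u i k) := by
        rw [Finset.mul_sum]
        refine Finset.sum_congr rfl fun k _ => ?_
        rw [hbv, hzu i, Pi.smul_apply, smul_eq_mul]
        ring
      rw [h2] at h1
      exact nonneg_of_mul_nonneg_right h1 (ht i)
    have hlim : Tendsto (fun i => ∑ k, ((q (φ i) k + t (φ i) * γ (φ i)) * u (φ i) k + v (φ i) k) *
        (x k - t (φ i) * u (φ i) k)) atTop
        (𝓝 (∑ k, ((p k + 0) * u₀ k + coords Θ M k) * (x k - 0 * u₀ k))) := by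
      refine tendsto_finsetSum _ fun k _ => ?_
      exact (((((tendsto_pi_nhds.1 hq k).comp hφt).add (htγ.comp hφt)).mul (hulim' k)).add
        ((tendsto_pi_nhds.1 hvlim k).comp hφt)).mul
        (tendsto_const_nhds.sub ((ht0.comp hφt).mul (hulim' k)))
    have := ge_of_tendsto' hlim fun i => hnonneg (φ i)
    simpa using this
  · refine lastCols_conj_eq_zero_of_rank_eq hP (t := t ∘ φ)
      (Δ := fun i => ofCoords Θ (u (φ i))) (fun i => (ht _).ne') (ht0.comp hφt)
      (((continuous_ofCoords Θ).tendsto u₀).comp hulim) fun i => ?_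
    have h := hrank (φ i)
    rwa [ofCoords_add, hΘ.ofCoords_coords hX.1, hzu (φ i), ofCoords_smul] at h

end Limit

/-! ### Sampling: frequencies, noise averages and choice of good realizations -/

section Indicator

variable {Ω : Type*} {d : ℕ}

/-- The indicator of the event that the `i`-th sampled index is `k`. -/
def hit (w : ℕ → Ω → Fin d) (k : Fin d) (i : ℕ) (a : Ω) : ℝ := if w i a = k then 1 else 0

lemma hit_nonneg (w : ℕ → Ω → Fin d) (k : Fin d) (i : ℕ) (a : Ω) : 0 ≤ hit w k i a := by
  unfold hit; split_ifs <;> norm_num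

lemma hit_le_one (w : ℕ → Ω → Fin d) (k : Fin d) (i : ℕ) (a : Ω) : hit w k i a ≤ 1 := by
  unfold hit; split_ifs <;> norm_num

end Indicator

section Sampling

variable {Ω : Type*} [MeasurableSpace Ω] {μ : Measure Ω}

/-- Weak law of large numbers with rate: centred, pairwise independent variables with second moment
at most one, scaled by `m s m` where `√m s m → ∞`. -/
lemma tendsto_measure_scaled_sum [IsProbabilityMeasure μ] {X : ℕ → Ω → ℝ}
    (hX : ∀ i, MemLp (X i) 2 μ)
    (hmean : ∀ i, ∫ a, X i a ∂μ = 0) (hsq : ∀ i, ∫ a, X i a ^ 2 ∂μ ≤ 1)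
    (hind : Pairwise fun i j => IndepFun (X i) (X j) μ) {s : ℕ → ℝ} (hs : ∀ m, 0 < s m)
    (hlim : Tendsto (fun m : ℕ => Real.sqrt m * s m) atTop atTop) {ε : ℝ} (hε : 0 < ε) :
    Tendsto (fun m : ℕ => μ {a | ε ≤ |(∑ i ∈ Finset.range m, X i a) / (m * s m)|}) atTop (𝓝 0) := by
  -- The Chebyshev bound: the sum has variance at most `m`, and the threshold is `ε * m * s m`.
  have hb : Tendsto (fun m : ℕ => ENNReal.ofReal (1 / (ε * (Real.sqrt m * s m)) ^ 2)) atTop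
      (𝓝 0) := by
    have h1 : Tendsto (fun m : ℕ => (ε * (Real.sqrt m * s m)) ^ 2) atTop atTop :=
      (tendsto_pow_atTop two_ne_zero).comp (hlim.const_mul_atTop hε)
    have h2 := ENNReal.tendsto_ofReal h1.inv_tendsto_atTop
    simpa using h2
  refine tendsto_of_tendsto_of_tendsto_of_le_of_le' tendsto_const_nhds hb
    (Eventually.of_forall fun _ => zero_le) ?_
  filter_upwards [eventually_gt_atTop 0] with m hm
  have hm' : (0 : ℝ) < m := by exact_mod_cast hm
  have hms : 0 < (m : ℝ) * s m := mul_pos hm' (hs m)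
  set S : Ω → ℝ := ∑ i ∈ Finset.range m, X i with hS
  have hSL : MemLp S 2 μ := memLp_finsetSum' _ fun i _ => hX i
  have hS0 : ∫ a, S a ∂μ = 0 := by
    simp only [hS, Finset.sum_apply]
    rw [integral_finsetSum _ fun i _ => (hX i).integrable one_le_two]
    simp [hmean]
  have hvar : variance S μ ≤ m := by
    rw [hS, IndepFun.variance_sum (fun i _ => hX i) (fun i _ j _ hij => hind hij)]
    calc ∑ i ∈ Finset.range m, variance (X i) μ ≤ ∑ i ∈ Finset.range m, (1 : ℝ) := by
          refine Finset.sum_le_sum fun i _ => ?_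
          rw [variance_of_integral_eq_zero (hX i).aemeasurable (hmean i)]
          exact hsq i
      _ = m := by simp
  have hset : {a | ε ≤ |(∑ i ∈ Finset.range m, X i a) / (m * s m)|} =
      {a | ε * (m * s m) ≤ |S a - ∫ a, S a ∂μ|} := by
    ext a
    rw [Set.mem_ofPred_eq, Set.mem_ofPred_eq, abs_div, abs_of_pos hms, le_div_iff₀ hms, hS0,
      sub_zero, hS, Finset.sum_apply]
  rw [hset]
  refine (meas_ge_le_variance_div_sq hSL (mul_pos hε hms)).trans (ENNReal.ofReal_le_ofReal ?_)
  have hsq : Real.sqrt m ^ 2 = m := Real.sq_sqrt hm'.le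
  have hsm := hs m
  calc variance S μ / (ε * (m * s m)) ^ 2 ≤ m / (ε * (m * s m)) ^ 2 := by gcongr
    _ = 1 / (ε * (Real.sqrt m * s m)) ^ 2 := by
      rw [mul_pow, mul_pow, mul_pow, mul_pow, hsq]
      field_simp

/-- An event of probability tending to one contains, for large indices, a point outside finitely
many events of vanishing probability and outside an event of probability at most one half. -/
lemma eventually_exists_good_point {ι : Type*} [Fintype ι] {A G : ℕ → Set Ω}
    {B : ι → ℕ → Set Ω} {Q : ℕ → Ω → Prop}
    (hA : Tendsto (fun m => μ (A m)) atTop (𝓝 1))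
    (hB : ∀ j, Tendsto (fun m => μ (B j m)) atTop (𝓝 0))
    (hG : ∀ᶠ m in atTop, μ (G m) ≤ 2⁻¹) (hQ : ∀ᶠ m in atTop, ∀ᵐ a ∂μ, Q m a) :
    ∀ᶠ m in atTop, ∃ a ∈ A m, (∀ j, a ∉ B j m) ∧ a ∉ G m ∧ Q m a := by
  have hsum : Tendsto (fun m => ∑ j, μ (B j m) + 2⁻¹) atTop (𝓝 (0 + 2⁻¹)) := by
    have := tendsto_finsetSum Finset.univ fun j _ => hB j
    rw [Finset.sum_const_zero] at this
    exact this.add tendsto_const_nhds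
  have hlt : (0 : ENNReal) + 2⁻¹ < 1 := by
    rw [zero_add]
    exact ENNReal.one_half_lt_one
  filter_upwards [hsum.eventually_lt hA hlt, hG, hQ] with m h1 h2 h3
  by_contra! hcon
  -- Only monotonicity and subadditivity of `μ` enter, so the events need not be measurable.
  have hsub : A m ⊆ ((⋃ j, B j m) ∪ G m) ∪ {a | ¬ Q m a} := by
    intro a ha
    by_contra hn
    simp only [Set.mem_union, Set.mem_iUnion, Set.mem_ofPred_eq, not_or, not_exists, not_not] at hn
    exact hcon a ha hn.1.1 hn.1.2 hn.2
  refine absurd h1 (not_lt.2 ?_)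
  calc μ (A m) ≤ μ (((⋃ j, B j m) ∪ G m) ∪ {a | ¬ Q m a}) := measure_mono hsub
    _ ≤ μ (⋃ j, B j m) + μ (G m) + μ {a | ¬ Q m a} :=
      (measure_union_le _ _).trans (by gcongr; exact measure_union_le _ _)
    _ ≤ ∑ j, μ (B j m) + 2⁻¹ + 0 := by
      gcongr
      · exact measure_iUnion_fintype_le _ _
      · exact (ae_iff.1 h3).le
    _ = _ := add_zero _

variable {d : ℕ} {α : Finset (Fin d)} {p : Fin d → ℝ} {w : ℕ → Ω → Fin d} {ξ : ℕ → Ω → ℝ}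

lemma measurable_hitFun (k : Fin d) : Measurable fun j : Fin d => if j = k then (1 : ℝ) else 0 :=
  measurable_of_finite _

lemma IsSamplingModel.measurable_hit (h : IsSamplingModel μ α p w ξ) (k : Fin d) (i : ℕ) :
    Measurable (hit w k i) :=
  (measurable_hitFun k).comp (h.measurable_index i)

lemma IsSamplingModel.memLp_hit [IsProbabilityMeasure μ] (h : IsSamplingModel μ α p w ξ)
    (k : Fin d) (i : ℕ) : MemLp (hit w k i) 2 μ :=
  MemLp.of_bound (h.measurable_hit k i).aestronglyMeasurable 1 <| ae_of_all _ fun a => by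
    rw [Real.norm_eq_abs, abs_of_nonneg (hit_nonneg w k i a)]
    exact hit_le_one w k i a

lemma IsSamplingModel.integral_hit [IsProbabilityMeasure μ] (h : IsSamplingModel μ α p w ξ)
    (k : Fin d) (i : ℕ) : ∫ a, hit w k i a ∂μ = p k := by
  have hm : MeasurableSet {a | w i a = k} := h.measurable_index i (measurableSet_singleton k)
  have : hit w k i = Set.indicator {a | w i a = k} 1 := by
    funext a
    simp [hit, Set.indicator_apply]
  rw [this, integral_indicator_one hm, h.law_index]

lemma IsSamplingModel.tendsto_measure_frequency [IsProbabilityMeasure μ]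
    (h : IsSamplingModel μ α p w ξ) (k : Fin d) {ε : ℝ} (hε : 0 < ε) :
    Tendsto (fun m : ℕ => μ {a | ε ≤ |(∑ i ∈ Finset.range m, hit w k i a) / m - p k|}) atTop
      (𝓝 0) := by
  have hL : ∀ i, MemLp (fun a => hit w k i a - p k) 2 μ := fun i =>
    (h.memLp_hit k i).sub (memLp_const _)
  have hmean : ∀ i, ∫ a, (hit w k i a - p k) ∂μ = 0 := fun i => by
    rw [integral_sub ((h.memLp_hit k i).integrable one_le_two) (integrable_const _),
      h.integral_hit]
    simp
  have hp0 : 0 ≤ p k := by rw [← h.law_index 0 k]; exact measureReal_nonneg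
  have hp1 : p k ≤ 1 := by rw [← h.law_index 0 k]; exact measureReal_le_one
  have hsq : ∀ i, ∫ a, (hit w k i a - p k) ^ 2 ∂μ ≤ 1 := fun i => by
    calc ∫ a, (hit w k i a - p k) ^ 2 ∂μ ≤ ∫ _, (1 : ℝ) ∂μ := by
          refine integral_mono (hL i).integrable_sq (integrable_const _) fun a => ?_
          have h0 := hit_nonneg w k i a
          have h1 := hit_le_one w k i a
          exact (sq_le_one_iff_abs_le_one _).2 (abs_le.2 ⟨by linarith, by linarith⟩)
      _ = 1 := by simp
  have hind : Pairwise fun i j => IndepFun (fun a => hit w k i a - p k)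
      (fun a => hit w k j a - p k) μ := fun i j hij => by
    have hφ : Measurable fun q : Fin d × ℝ => (if q.1 = k then (1 : ℝ) else 0) - p k :=
      ((measurable_hitFun k).comp measurable_fst).sub_const _
    exact (h.indep.indepFun hij).comp hφ hφ
  have hlim : Tendsto (fun m : ℕ => Real.sqrt m * 1) atTop atTop := by
    simpa [Function.comp_def] using
      Real.tendsto_sqrt_atTop.comp (tendsto_natCast_atTop_atTop (R := ℝ))
  refine (tendsto_measure_scaled_sum hL hmean hsq hind (fun _ => one_pos) hlim hε).congr' ?_
  filter_upwards [eventually_gt_atTop 0] with m hm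
  have hm' : (m : ℝ) ≠ 0 := by exact_mod_cast hm.ne'
  congr 1
  ext a
  rw [Set.mem_ofPred_eq, Set.mem_ofPred_eq, Finset.sum_sub_distrib, Finset.sum_const,
    Finset.card_range, nsmul_eq_mul, mul_one, sub_div, mul_div_cancel_left₀ _ hm']

/-- Each summand is centred because index and noise are independent, and has second moment at most
that of the noise; the rate `√m s → ∞` does the rest. -/
lemma IsSamplingModel.tendsto_measure_noise [IsProbabilityMeasure μ]
    (h : IsSamplingModel μ α p w ξ) (k : Fin d) {s : ℕ → ℝ} (hs : ∀ m, 0 < s m)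
    (hlim : Tendsto (fun m : ℕ => Real.sqrt m * s m) atTop atTop) {ε : ℝ} (hε : 0 < ε) :
    Tendsto (fun m : ℕ => μ {a | ε ≤ |(∑ i ∈ Finset.range m, hit w k i a * ξ i a) / (m * s m)|})
      atTop (𝓝 0) := by
  have hle : ∀ i a, ‖hit w k i a * ξ i a‖ ≤ ‖ξ i a‖ := fun i a => by
    rw [norm_mul, Real.norm_eq_abs, abs_of_nonneg (hit_nonneg w k i a)]
    exact mul_le_of_le_one_left (norm_nonneg _) (hit_le_one w k i a)
  have hL : ∀ i, MemLp (fun a => hit w k i a * ξ i a) 2 μ := fun i =>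
    (h.memLp_noise i).of_le
      ((h.measurable_hit k i).mul (h.measurable_noise i)).aestronglyMeasurable
      (ae_of_all _ (hle i))
  have hmean : ∀ i, ∫ a, hit w k i a * ξ i a ∂μ = 0 := fun i => by
    have hi : IndepFun (hit w k i) (ξ i) μ :=
      (h.indep_index_noise i).comp (measurable_hitFun k) measurable_id
    rw [hi.integral_fun_mul_eq_mul_integral (h.measurable_hit k i).aestronglyMeasurable
      (h.measurable_noise i).aestronglyMeasurable, h.mean_noise, mul_zero]
  have hsq : ∀ i, ∫ a, (hit w k i a * ξ i a) ^ 2 ∂μ ≤ 1 := fun i => by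
    rw [← h.sq_noise i]
    refine integral_mono (hL i).integrable_sq (h.memLp_noise i).integrable_sq fun a => ?_
    exact sq_le_sq.2 (hle i a)
  have hind : Pairwise fun i j => IndepFun (fun a => hit w k i a * ξ i a)
      (fun a => hit w k j a * ξ j a) μ := fun i j hij => by
    have hφ : Measurable fun q : Fin d × ℝ => (if q.1 = k then (1 : ℝ) else 0) * q.2 :=
      ((measurable_hitFun k).comp measurable_fst).mul measurable_snd
    exact (h.indep.indepFun hij).comp hφ hφ
  exact tendsto_measure_scaled_sum hL hmean hsq hind hs hlim hε

end Sampling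

/-! ### The objective in coordinates -/

section Objective

variable {𝕜 : Type*} [RCLike 𝕜] {n d : ℕ} {Θ : Fin d → Matrix (Fin n) (Fin n) 𝕜}

lemma trInner_self_nonneg (X : Matrix (Fin n) (Fin n) 𝕜) : 0 ≤ trInner X X :=
  (RCLike.nonneg_iff.1 (posSemidef_conjTranspose_mul_self X).trace_nonneg).1

lemma frobNorm_sq (X : Matrix (Fin n) (Fin n) 𝕜) : frobNorm X ^ 2 = trInner X X :=
  Real.sq_sqrt (trInner_self_nonneg X)

lemma IsHermitianOrthonormalBasis.norm_coords_le (hΘ : IsHermitianOrthonormalBasis Θ)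
    {X : Matrix (Fin n) (Fin n) 𝕜} (hX : X.IsHermitian) : ‖coords Θ X‖ ≤ frobNorm X := by
  have h0 : 0 ≤ frobNorm X := Real.sqrt_nonneg _
  refine (abs_le_of_sq_le_sq' ?_ h0).2
  rw [frobNorm_sq]
  conv_rhs => rw [← hΘ.ofCoords_coords hX, trInner_ofCoords, hΘ.coords_ofCoords]
  simpa [sq] using sq_norm_le_sum_sq (coords Θ X)

/-- The objective is a separable quadratic function of the coordinates. -/
lemma IsHermitianOrthonormalBasis.objective_eq_quadFun (hΘ : IsHermitianOrthonormalBasis Θ)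
    (X G Xtil : Matrix (Fin n) (Fin n) 𝕜) (m : ℕ) (w : ℕ → Fin d) (y ξ : ℕ → ℝ) (ν ρ γ : ℝ)
    (hy : ∀ i, y i = trInner (Θ (w i)) X + ν * ξ i) (z : Fin d → ℝ) :
    objective Θ m w y ρ γ G Xtil (X + ofCoords Θ z) = objective Θ m w y ρ γ G Xtil X +
      quadFun
        (fun k => (∑ i ∈ Finset.range m, if w i = k then (1 : ℝ) else 0) / m + ρ * γ)
        (fun k => ρ * (coords Θ (1 - G) k + γ * coords Θ (X - Xtil) k) -
          ν * ((∑ i ∈ Finset.range m, (if w i = k then (1 : ℝ) else 0) * ξ i) / m)) z := by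
  have hw : ∀ i, trInner (Θ (w i)) (ofCoords Θ z) = z (w i) := fun i =>
    congrFun (hΘ.coords_ofCoords z) (w i)
  have hself : trInner (ofCoords Θ z) (ofCoords Θ z) = ∑ k, z k ^ 2 := by
    rw [trInner_ofCoords, hΘ.coords_ofCoords]
    simp only [sq]
  have hfrob : frobNorm (X + ofCoords Θ z - Xtil) ^ 2 =
      frobNorm (X - Xtil) ^ 2 + 2 * ∑ k, coords Θ (X - Xtil) k * z k + ∑ k, z k ^ 2 := by
    rw [add_sub_right_comm, frobNorm_sq, frobNorm_sq, trInner_add_left, trInner_add_right,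
      trInner_add_right, trInner_comm (ofCoords Θ z) (X - Xtil), hself, trInner_ofCoords]
    ring
  have hquad : ∑ i ∈ Finset.range m, (y i - trInner (Θ (w i)) (X + ofCoords Θ z)) ^ 2 =
      ∑ i ∈ Finset.range m, (y i - trInner (Θ (w i)) X) ^ 2 +
      ∑ k, (∑ i ∈ Finset.range m, if w i = k then (1 : ℝ) else 0) * z k ^ 2 -
      2 * ν * ∑ k, (∑ i ∈ Finset.range m, (if w i = k then (1 : ℝ) else 0) * ξ i) * z k := by
    -- Samples are regrouped by index: each sample sees a single coordinate of `z`, which is why the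
    -- Hessian is diagonal.
    have h1 : ∑ k, (∑ i ∈ Finset.range m, if w i = k then (1 : ℝ) else 0) * z k ^ 2 =
        ∑ i ∈ Finset.range m, z (w i) ^ 2 := by
      simp only [Finset.sum_mul]
      rw [Finset.sum_comm]
      simp
    have h2 : ∑ k, (∑ i ∈ Finset.range m, (if w i = k then (1 : ℝ) else 0) * ξ i) * z k =
        ∑ i ∈ Finset.range m, ξ i * z (w i) := by
      simp only [Finset.sum_mul]
      rw [Finset.sum_comm]
      simp
    rw [h1, h2, Finset.mul_sum, ← Finset.sum_add_distrib, ← Finset.sum_sub_distrib]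
    refine Finset.sum_congr rfl fun i _ => ?_
    rw [trInner_add_right, hw, hy]
    ring
  rw [objective, objective, hquad, hfrob, trInner_add_right, trInner_ofCoords]
  have hq : quadFun
        (fun k => (∑ i ∈ Finset.range m, if w i = k then (1 : ℝ) else 0) / m + ρ * γ)
        (fun k => ρ * (coords Θ (1 - G) k + γ * coords Θ (X - Xtil) k) -
          ν * ((∑ i ∈ Finset.range m, (if w i = k then (1 : ℝ) else 0) * ξ i) / m)) z =
      1 / (2 * (m : ℝ)) * ∑ k, (∑ i ∈ Finset.range m, if w i = k then (1 : ℝ) else 0) * z k ^ 2 +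
      ρ * γ / 2 * ∑ k, z k ^ 2 + ρ * ∑ k, coords Θ (1 - G) k * z k +
      ρ * γ * ∑ k, coords Θ (X - Xtil) k * z k -
      ν * (1 / m) *
        ∑ k, (∑ i ∈ Finset.range m, (if w i = k then (1 : ℝ) else 0) * ξ i) * z k := by
    simp only [quadFun, Finset.mul_sum, ← Finset.sum_add_distrib, ← Finset.sum_sub_distrib]
    refine Finset.sum_congr rfl fun k _ => ?_
    generalize (∑ i ∈ Finset.range m, if w i = k then (1 : ℝ) else 0) = A
    generalize (∑ i ∈ Finset.range m, (if w i = k then (1 : ℝ) else 0) * ξ i) = B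
    rw [one_div_mul_eq_div, one_div]
    ring
  rw [hq]
  ring

lemma IsHermitianOrthonormalBasis.mem_feasibleCoords_iff (hΘ : IsHermitianOrthonormalBasis Θ)
    {α : Finset (Fin d)} {X : Matrix (Fin n) (Fin n) 𝕜} (hX : X.IsHermitian) (z : Fin d → ℝ) :
    z ∈ feasibleCoords Θ α (coords Θ X) ↔ X + ofCoords Θ z ∈ feasibleSet Θ α X := by
  have h : ∀ k, trInner (Θ k) (ofCoords Θ z) = z k := congrFun (hΘ.coords_ofCoords z)
  simp only [feasibleCoords, feasibleSet, Set.mem_ofPred_eq, ofCoords_add,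
    hΘ.ofCoords_coords hX, trInner_add_right, h, add_eq_left, and_comm]

lemma IsHermitianOrthonormalBasis.add_ofCoords_sub (hΘ : IsHermitianOrthonormalBasis Θ)
    {X Y : Matrix (Fin n) (Fin n) 𝕜} (hX : X.IsHermitian) (hY : Y.IsHermitian) :
    X + ofCoords Θ (coords Θ (Y - X)) = Y := by
  rw [hΘ.ofCoords_coords (hY.sub hX), add_sub_cancel]

lemma IsHermitianOrthonormalBasis.isOptimal_iff_coords (hΘ : IsHermitianOrthonormalBasis Θ)
    {α : Finset (Fin d)} {X : Matrix (Fin n) (Fin n) 𝕜} (hX : X.IsHermitian)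
    {φ : Matrix (Fin n) (Fin n) 𝕜 → ℝ} {ψ : (Fin d → ℝ) → ℝ} {K : ℝ}
    (hφ : ∀ z, φ (X + ofCoords Θ z) = K + ψ z) (z : Fin d → ℝ) :
    IsOptimal (feasibleSet Θ α X) φ (X + ofCoords Θ z) ↔
      IsOptimal (feasibleCoords Θ α (coords Θ X)) ψ z := by
  refine and_congr (hΘ.mem_feasibleCoords_iff hX z).symm ⟨fun h x hx => ?_, fun h Y hY => ?_⟩
  · have := h ((hΘ.mem_feasibleCoords_iff hX x).1 hx)
    simpa [hφ] using this
  · have e := hΘ.add_ofCoords_sub hX hY.1.1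
    have hY' := hY
    rw [← e] at hY'
    have := h ((hΘ.mem_feasibleCoords_iff hX _).2 hY')
    rw [Set.mem_ofPred_eq] at this ⊢
    rw [← e, hφ, hφ]
    exact add_le_add_right this K

end Objective

lemma exists_pos_two_mul_le {d : ℕ} {α : Finset (Fin d)} {p : Fin d → ℝ}
    (hp : ∀ k, k ∉ α → 0 < p k) : ∃ c : ℝ, 0 < c ∧ ∀ k ∉ α, 2 * c ≤ p k := by
  rcases (αᶜ).eq_empty_or_nonempty with h | h
  · refine ⟨1, one_pos, fun k hk => ?_⟩
    simp [← Finset.mem_compl, h] at hk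
  · refine ⟨(αᶜ).inf' h p / 2, half_pos ((Finset.lt_inf'_iff h).2 fun k hk => hp k (by simpa using hk)),
      fun k hk => ?_⟩
    rw [mul_div_cancel₀ _ two_ne_zero]
    exact Finset.inf'_le p (by simpa using hk)

end RankCorrection

/-! ### Selection of realizations and conclusion -/

theorem mainTheorem7
    {𝕜 : Type*} [RCLike 𝕜] {n d : ℕ}
    {Ω : Type*} [MeasurableSpace Ω] (μ : Measure Ω) [IsProbabilityMeasure μ]
    -- the orthonormal basis, the fixed indices and the true matrix
    (Θ : Fin d → Matrix (Fin n) (Fin n) 𝕜)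
    (hΘ : RankCorrection.IsHermitianOrthonormalBasis Θ)
    (α : Finset (Fin d))
    (Xbar : Matrix (Fin n) (Fin n) 𝕜) (hXbar : Xbar.PosSemidef) (hrank : 1 ≤ Xbar.rank)
    -- the observation model `y_i = ⟨Θ_{ω_i}, Xbar⟩ + ν ξ_i`
    (p : Fin d → ℝ) (w : ℕ → Ω → Fin d) (ξ : ℕ → Ω → ℝ)
    (hsample : RankCorrection.IsSamplingModel μ α p w ξ)
    (ν : ℝ) (hν : 0 < ν) (y : ℕ → Ω → ℝ)
    (hy : ∀ i a, y i a = RankCorrection.trInner (Θ (w i a)) Xbar + ν * ξ i a)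
    -- the spectral operator, continuous at `Xbar`
    (f : (Fin n → ℝ) → (Fin n → ℝ))
    (F : Matrix (Fin n) (Fin n) 𝕜 → Matrix (Fin n) (Fin n) 𝕜)
    (hF : RankCorrection.IsSpectralOperator f F)
    (hFcont : ContinuousWithinAt F {X | X.IsHermitian} Xbar)
    -- the initial estimator, consistent
    (Xtil : ℕ → Ω → Matrix (Fin n) (Fin n) 𝕜)
    (hXtil : ∀ m, ∀ᵐ a ∂μ, (Xtil m a).PosSemidef)
    (hXtil_lim : TendstoInMeasure μ
      (fun m a => RankCorrection.frobNorm (Xtil m a - Xbar)) atTop (fun _ => (0 : ℝ)))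
    -- the Slater condition
    (hSlater : ∃ X0 : Matrix (Fin n) (Fin n) 𝕜, X0.PosDef ∧
      ∀ k ∈ α, RankCorrection.trInner (Θ k) X0 = RankCorrection.trInner (Θ k) Xbar)
    -- the regularization parameters
    (ρ : ℕ → ℝ) (hρ_pos : ∀ m, 0 < ρ m) (hρ_lim : Tendsto ρ atTop (𝓝 0))
    (hρ_rate : Tendsto (fun m : ℕ => Real.sqrt (m : ℝ) * ρ m) atTop atTop)
    (γ : ℕ → Ω → ℝ) (hγ_nonneg : ∀ m, ∀ᵐ a ∂μ, 0 ≤ γ m a)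
    (hγ_bdd : RankCorrection.BoundedInProbability μ γ)
    -- the estimator: an optimal solution of the rank-correction step (whenever there is one)
    (Xhat : ℕ → Ω → Matrix (Fin n) (Fin n) 𝕜)
    (hXhat : ∀ m, 1 ≤ m → ∀ᵐ a ∂μ,
      (∃ X, RankCorrection.IsOptimal (RankCorrection.feasibleSet Θ α Xbar)
        (RankCorrection.objective Θ m (fun i => w i a) (fun i => y i a) (ρ m) (γ m a)
          (F (Xtil m a)) (Xtil m a)) X) →
      RankCorrection.IsOptimal (RankCorrection.feasibleSet Θ α Xbar)
        (RankCorrection.objective Θ m (fun i => w i a) (fun i => y i a) (ρ m) (γ m a)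
          (F (Xtil m a)) (Xtil m a)) (Xhat m a))
    -- rank consistency of the estimator
    (hcons : RankCorrection.RankConsistent μ Xhat Xbar)
    -- the blocks `P = [P₁ P₂]` of an eigenvector matrix of `Xbar`
    (P : Matrix (Fin n) (Fin n) 𝕜) (hP : P ∈ RankCorrection.orderedEigenbases Xbar)
    (P₂ : Matrix (Fin n) (Fin (n - Xbar.rank)) 𝕜)
    (hP₂ : P₂ = RankCorrection.lastCols Xbar.rank P) :
    ∃ L : Matrix (Fin (n - Xbar.rank)) (Fin (n - Xbar.rank)) 𝕜, L.PosSemidef ∧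
      P₂ᴴ * RankCorrection.Qdag Θ αᶜ p (P₂ * L * P₂ᴴ) * P₂ =
        P₂ᴴ * RankCorrection.Qdag Θ αᶜ p (1 - F Xbar) * P₂ := by
  obtain ⟨X0, hX0, hX0α⟩ := hSlater
  subst hP₂
  obtain ⟨c, hc, hcp⟩ := RankCorrection.exists_pos_two_mul_le hsample.prob_pos
  -- A single bound failing with probability at most one half suffices, as the other bad events have
  -- vanishing probability.
  obtain ⟨C, hC⟩ := hγ_bdd (1 / 2) (by norm_num)
  have hgood : ∀ ε : ℝ, 0 < ε → ∀ᶠ m in atTop, ∃ a ∈ {a | (Xhat m a).rank = Xbar.rank},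
      (∀ j : Fin d ⊕ Fin d ⊕ Unit, a ∉ Sum.elim
        (fun k => {a | ε ≤ |(∑ i ∈ Finset.range m, RankCorrection.hit w k i a) / m - p k|})
        (Sum.elim
          (fun k => {a | ε ≤ |(∑ i ∈ Finset.range m, RankCorrection.hit w k i a * ξ i a) /
            (m * ρ m)|})
          (fun _ => {a | ε ≤ ‖RankCorrection.frobNorm (Xtil m a - Xbar) - 0‖})) j) ∧
      a ∉ {a | C < |γ m a|} ∧
      ((Xtil m a).PosSemidef ∧ 0 ≤ γ m a ∧
        ((∃ X, RankCorrection.IsOptimal (RankCorrection.feasibleSet Θ α Xbar)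
          (RankCorrection.objective Θ m (fun i => w i a) (fun i => y i a) (ρ m) (γ m a)
            (F (Xtil m a)) (Xtil m a)) X) →
        RankCorrection.IsOptimal (RankCorrection.feasibleSet Θ α Xbar)
          (RankCorrection.objective Θ m (fun i => w i a) (fun i => y i a) (ρ m) (γ m a)
            (F (Xtil m a)) (Xtil m a)) (Xhat m a))) := by
    intro ε hε
    refine RankCorrection.eventually_exists_good_point (B := fun j m => Sum.elim
        (fun k => {a | ε ≤ |(∑ i ∈ Finset.range m, RankCorrection.hit w k i a) / m - p k|})
        (Sum.elim
          (fun k => {a | ε ≤ |(∑ i ∈ Finset.range m, RankCorrection.hit w k i a * ξ i a) /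
            (m * ρ m)|})
          (fun _ => {a | ε ≤ ‖RankCorrection.frobNorm (Xtil m a - Xbar) - 0‖})) j)
      hcons ?_ ?_ ?_
    · rintro (k | k | -)
      · exact hsample.tendsto_measure_frequency k hε
      · exact hsample.tendsto_measure_noise k hρ_pos hρ_rate hε
      · exact tendstoInMeasure_iff_norm.1 hXtil_lim ε hε
    · filter_upwards [hC] with m hm
      refine hm.trans (le_of_eq ?_)
      rw [one_div, ENNReal.ofReal_inv_of_pos two_pos, ENNReal.ofReal_ofNat]
    · filter_upwards [eventually_ge_atTop 1] with m hm
      filter_upwards [hXtil m, hγ_nonneg m, hXhat m hm] with a h1 h2 h3 using ⟨h1, h2, h3⟩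
  -- These tolerances tend to zero and never exceed `c`; since `2 * c ≤ p k` off `α`, all
  -- frequencies there stay at least `c`.
  have hε : ∀ j : ℕ, 0 < c / ((j : ℝ) + 1) := fun j => by positivity
  have hεlim : Tendsto (fun j : ℕ => c / ((j : ℝ) + 1)) atTop (𝓝 0) :=
    tendsto_const_nhds.div_atTop (tendsto_atTop_add_const_right _ _ tendsto_natCast_atTop_atTop)
  have hεc : ∀ j : ℕ, c / ((j : ℝ) + 1) ≤ c := fun j =>
    div_le_self hc.le (by linarith [(Nat.cast_nonneg j : (0 : ℝ) ≤ j)])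
  -- The sample point may change with `j`: the remaining argument is deterministic along the
  -- sequence `(M j, a j)`.
  choose M hM a hrk hB hγC hpsd hγ0 hopt using fun j : ℕ =>
    ((eventually_ge_atTop j).and (hgood _ (hε j))).exists
  have hMlim : Tendsto M atTop atTop := tendsto_atTop_mono hM tendsto_id
  have hB1 : ∀ j k, |(∑ i ∈ Finset.range (M j), RankCorrection.hit w k i (a j)) / (M j : ℝ) - p k| <
      c / ((j : ℝ) + 1) := fun j k => not_le.1 (hB j (Sum.inl k))
  have hB2 : ∀ j k, |(∑ i ∈ Finset.range (M j), RankCorrection.hit w k i (a j) * ξ i (a j)) /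
      ((M j : ℝ) * ρ (M j))| < c / ((j : ℝ) + 1) := fun j k => not_le.1 (hB j (Sum.inr (Sum.inl k)))
  have hB3 : ∀ j, ‖RankCorrection.frobNorm (Xtil (M j) (a j) - Xbar) - 0‖ < c / ((j : ℝ) + 1) :=
    fun j => not_le.1 (hB j (Sum.inr (Sum.inr ())))
  have hXb := hXbar.1
  have hdev : Tendsto (fun j => RankCorrection.coords Θ (Xtil (M j) (a j) - Xbar)) atTop (𝓝 0) := by
    refine squeeze_zero_norm (fun j => ?_) hεlim
    refine (hΘ.norm_coords_le ((hpsd j).1.sub hXb)).trans ?_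
    have := hB3 j
    rw [sub_zero] at this
    exact (le_abs_self _).trans this.le
  have hXlim : Tendsto (fun j => Xtil (M j) (a j)) atTop (𝓝 Xbar) := by
    have h1 := (((RankCorrection.continuous_ofCoords Θ).tendsto 0).comp hdev).const_add Xbar
    rw [RankCorrection.ofCoords_zero, add_zero] at h1
    refine h1.congr fun j => ?_
    exact hΘ.add_ofCoords_sub hXb (hpsd j).1
  have hFlim : Tendsto (fun j => F (Xtil (M j) (a j))) atTop (𝓝 (F Xbar)) :=
    hFcont.tendsto.comp (tendsto_nhdsWithin_iff.2 ⟨hXlim, Eventually.of_forall fun j => (hpsd j).1⟩)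
  have hqc : ∀ j, ∀ k ∉ α,
      c ≤ (∑ i ∈ Finset.range (M j), RankCorrection.hit w k i (a j)) / (M j : ℝ) := fun j k hk => by
    have h1 := (abs_lt.1 (hB1 j k)).1
    have h2 := hεc j
    have h3 := hcp k hk
    linarith
  have h0S : (0 : Fin d → ℝ) ∈
      RankCorrection.feasibleCoords Θ α (RankCorrection.coords Θ Xbar) :=
    ⟨fun _ _ => rfl, by rwa [add_zero, hΘ.ofCoords_coords hXb]⟩
  have hobj := fun j => hΘ.objective_eq_quadFun Xbar (F (Xtil (M j) (a j))) (Xtil (M j) (a j)) (M j)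
    (fun i => w i (a j)) (fun i => y i (a j)) (fun i => ξ i (a j)) ν (ρ (M j)) (γ (M j) (a j))
    (fun i => hy i (a j))
  -- Frequencies bounded below off `α` make the problem coercive, so a minimizer exists and the
  -- conditional assumption on the estimator applies.
  have hsol : ∀ j, RankCorrection.IsOptimal (RankCorrection.feasibleSet Θ α Xbar)
      (RankCorrection.objective Θ (M j) (fun i => w i (a j)) (fun i => y i (a j)) (ρ (M j))
        (γ (M j) (a j)) (F (Xtil (M j) (a j))) (Xtil (M j) (a j))) (Xhat (M j) (a j)) := fun j => by
    refine hopt j ?_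
    obtain ⟨z, hz⟩ := RankCorrection.exists_isOptimal_quadFun
      (hΘ.isClosed_feasibleCoords α (RankCorrection.coords Θ Xbar)) h0S hc
      (a := fun k => (∑ i ∈ Finset.range (M j), if w i (a j) = k then (1 : ℝ) else 0) / (M j : ℝ) +
        ρ (M j) * γ (M j) (a j))
      (b := fun k => ρ (M j) * (RankCorrection.coords Θ (1 - F (Xtil (M j) (a j))) k +
        γ (M j) (a j) * RankCorrection.coords Θ (Xbar - Xtil (M j) (a j)) k) -
          ν * ((∑ i ∈ Finset.range (M j), (if w i (a j) = k then (1 : ℝ) else 0) * ξ i (a j)) /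
            (M j : ℝ)))
      (fun z hz k hk => (hqc j k fun hkα => hk (hz.1 k hkα)).trans
        (le_add_of_nonneg_right (mul_nonneg (hρ_pos _).le (hγ0 j))))
    exact ⟨_, (hΘ.isOptimal_iff_coords hXb (hobj j) z).2 hz⟩
  have hrepr := fun j => hΘ.add_ofCoords_sub hXb (hsol j).1.1.1
  refine hΘ.exists_solution_of_seq hXbar hX0 hX0α hP hsample.prob_pos hc (M := 1 - F Xbar)
    (t := fun j => ρ (M j)) (γ := fun j => γ (M j) (a j)) (C := C)
    (q := fun j k => (∑ i ∈ Finset.range (M j), RankCorrection.hit w k i (a j)) / (M j : ℝ))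
    (N := fun j k => ν * ((∑ i ∈ Finset.range (M j), RankCorrection.hit w k i (a j) * ξ i (a j)) /
      (M j : ℝ)))
    (h := fun j => RankCorrection.coords Θ (1 - F (Xtil (M j) (a j))))
    (e := fun j => RankCorrection.coords Θ (Xbar - Xtil (M j) (a j)))
    (z := fun j => RankCorrection.coords Θ (Xhat (M j) (a j) - Xbar))
    (fun j => hρ_pos _) (hρ_lim.comp hMlim) hγ0
    (fun j => (le_abs_self _).trans (not_lt.1 (hγC j))) ?_ hqc ?_ ?_ ?_ ?_ ?_
  · refine tendsto_pi_nhds.2 fun k => tendsto_iff_norm_sub_tendsto_zero.2 ?_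
    exact squeeze_zero (fun _ => norm_nonneg _) (fun j => (hB1 j k).le) hεlim
  · intro k
    have h1 := (squeeze_zero_norm (fun j => (hB2 j k).le) hεlim).const_mul ν
    rw [mul_zero] at h1
    refine h1.congr fun j => ?_
    rw [mul_div_assoc, div_div]
  · refine tendsto_pi_nhds.2 fun k => ?_
    exact ((RankCorrection.continuous_trInner_right (Θ k)).tendsto _).comp (hFlim.const_sub 1)
  · have h1 := hdev.neg
    rw [neg_zero] at h1
    refine h1.congr fun j => funext fun k => ?_
    simp only [Pi.neg_apply, RankCorrection.coords, RankCorrection.trInner_sub_right, neg_sub]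
  · intro j
    refine (hΘ.isOptimal_iff_coords hXb (hobj j) _).1 ?_
    rw [hrepr]
    exact hsol j
  · intro j
    rw [RankCorrection.ofCoords_add, hΘ.ofCoords_coords hXb, hrepr]
    exact hrk j
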